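/- **Setting.** A directed mixed graph on a vertex set $V$ has directed edges $j\to k$ and (symmetric) bidirected edges $j\leftrightarrow k$. An *ADMG* is a directed mixed graph without directed cycles that contains all bidirected loops $j\leftrightarrow j$. It is *unconfounded* if a bidirected edge between two distinct vertices only joins vertices without parents, and a *DAG* if it has no bidirected edges except the loops. For $V\subseteq V'$ and an ADMG $G'$ on $V'$, the marginal graph $\mathrm{marg}_V(G')$ on $V$ contains all bidirected loops and, for distinct $j,k\in V$, the edge $j\to k$ iff $G'$ has a directed path from $j$ to $k$ with no non-endpoint in $V$, and $j\leftrightarrow k$ iff $G'$ has a path from $j$ to $k$ without colliders, with arrowheads at both endpoints, and with no non-endpoint in $V$. Let $V$ be finite and let $\mathbb V=\prod_{v\in V}\mathbb V_v$ be a product of measurable spaces, each with a $\sigma$-finite reference measure (for example Lebesgue or counting measure on a subset of $\mathbb R^{n_v}$). The global Markov model $\mathbb P_{\mathrm{GM}}(G,\mathbb V)$ of a graph $G$ on $V$ is the set of all probability measures on $\mathbb V$ that have a density with respect to the product measure and for which $J\perp K\mid L$ (factorization of the conditional densities almost everywhere where $p(v_L)>0$) whenever $J,K,L\subseteq V$ are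 pairwise disjoint and $J,K$ are m-separated by $L$ in $G$, that is, no walk from a vertex of $J$ to a vertex of $K$ has all its colliders in $L$ and all its non-colliders outside $L$. Let $\mathcal C(G)$ be the set of bidirected cliques, i.e. of sets $C\subseteq V$ with $j\leftrightarrow k$ in $G$ for all $j,k\in C$. The clique expansion graph $\mathrm{expand}_C(G)$ is the DAG on $V\cup\{E_C: C\in\mathcal C(G)\}$ with the directed edges of $G$ and the edges $E_C\to j$ for $j\in C\in\mathcal C(G)$. The clique expansion model is $$\mathbb P_{\mathrm{CE}}(G,\mathbb V)=\mathrm{marg}_V\Big(\mathbb P_{\mathrm{GM}}\big(\mathrm{expand}_C(G),\ \mathbb V\times[0,1]^{|\mathcal C(G)|}\big)\Big),$$ where $\mathrm{marg}_V$ denotes the $V$-marginal of distributions and $[0,1]$ carries Lebesgue measure. **Proposition.** For every ADMG $G$ on $V$, $$\begin{aligned}\mathbb P_{\mathrm{CE}}(G,\mathbb V)&=\mathrm{marg}_V\Big(\mathbb P_{\mathrm{CE}}\big(\mathrm{expand}_C(G),\ \mathbb V\times[0,1]^{|\mathcal C(G)|}\big)\Big)\\&=\bigcup_{G'}\mathrm{marg}_V\Big(\mathbb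 P_{\mathrm{CE}}\big(G',\ \mathbb V\times[0,1]^{|V'|-|V|}\big)\Big),\end{aligned}$$ where the union may be taken over any of the following three classes, with the same result: all DAGs $G'$, all unconfounded ADMGs $G'$, or all ADMGs $G'$, in each case on an arbitrary finite vertex set $V'\supseteq V$ and with $\mathrm{marg}_V(G')=G$. -/

import Mathlib

open MeasureTheory
open scoped ENNReal

universe u

/-- A directed mixed graph on the vertex set `V`; loops of either kind are allowed. -/
@[ext]
structure MixedGraph (V : Type*) where
  /-- `dir j k` is the directed edge `j → k`. -/
  dir : V → V → Prop
  /-- `bidir j k` is the bidirected edge `j ↔ k`. -/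
  bidir : V → V → Prop
  bidir_symm : ∀ j k, bidir j k → bidir k j

/-- The ways in which an edge can be traversed: `src → tgt`, `src ← tgt`, `src ↔ tgt`. -/
inductive EdgeType
  | right
  | left
  | bi

/-- One step of a walk, from `src` to `tgt`. -/
structure Step (V : Type*) where
  src : V
  tgt : V
  type : EdgeType

namespace Step

variable {V : Type*}

/-- The edge of the step has an arrowhead at its starting vertex. -/
def HeadAtSrc (s : Step V) : Prop := s.type = .left ∨ s.type = .bi

/-- The edge of the step has an arrowhead at its final vertex. -/
def HeadAtTgt (s : Step V) : Prop := s.type = .right ∨ s.type = .bi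

/-- The vertex between the consecutive steps `s` and `t` is a collider. -/
def Collider (s t : Step V) : Prop := s.HeadAtTgt ∧ t.HeadAtSrc

/-- The edge of the step is an edge of the graph `G`. -/
def IsEdgeOf (G : MixedGraph V) (s : Step V) : Prop :=
  match s.type with
  | .right => G.dir s.src s.tgt
  | .left => G.dir s.tgt s.src
  | .bi => G.bidir s.src s.tgt

/-- The same edge traversed backwards. -/
def rev (s : Step V) : Step V where
  src := s.tgt
  tgt := s.src
  type := match s.type with
    | .right => .left
    | .left => .right
    | .bi => .bi

theorem headAtSrc_rev (s : Step V) : s.rev.HeadAtSrc ↔ s.HeadAtTgt := by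
  obtain ⟨a, b, t⟩ := s
  cases t <;> simp [rev, HeadAtSrc, HeadAtTgt]

theorem headAtTgt_rev (s : Step V) : s.rev.HeadAtTgt ↔ s.HeadAtSrc := by
  obtain ⟨a, b, t⟩ := s
  cases t <;> simp [rev, HeadAtSrc, HeadAtTgt]

theorem isEdgeOf_rev {G : MixedGraph V} {s : Step V} (h : s.IsEdgeOf G) : s.rev.IsEdgeOf G := by
  obtain ⟨a, b, t⟩ := s
  cases t
  · exact h
  · exact h
  · exact G.bidir_symm _ _ h

end Step

namespace MixedGraph

variable {V : Type*}

/-- `w` is a walk in `G` from `j` to `k`: a sequence of one or more connecting edges. -/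
structure IsWalk (G : MixedGraph V) (w : List (Step V)) (j k : V) : Prop where
  isEdgeOf : ∀ s ∈ w, s.IsEdgeOf G
  connected : w.IsChain fun s t => s.tgt = t.src
  head : ∃ s ∈ w.head?, s.src = j
  last : ∃ s ∈ w.getLast?, s.tgt = k

/-- `w` is a path in `G` from `j` to `k`: a walk in which every vertex appears only once. -/
structure IsPath (G : MixedGraph V) (w : List (Step V)) (j k : V) : Prop
    extends G.IsWalk w j k where
  nodup : (j :: w.map Step.tgt).Nodup

/-- No non-endpoint of the walk `w` lies in `J`. -/
def NoInner (w : List (Step V)) (J : Set V) : Prop := ∀ s ∈ w.dropLast, s.tgt ∉ J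

/-- `w` is a directed path from `j` to `k`. -/
def IsDirectedPath (G : MixedGraph V) (w : List (Step V)) (j k : V) : Prop :=
  G.IsPath w j k ∧ ∀ s ∈ w, s.type = .right

/-- `w` is a confounding arc from `j` to `k`: a path without colliders that has an arrowhead
at both of its endpoints. -/
structure IsConfoundingArc (G : MixedGraph V) (w : List (Step V)) (j k : V) : Prop
    extends G.IsPath w j k where
  noCollider : w.IsChain fun s t => ¬ s.Collider t
  headSrc : ∀ s ∈ w.head?, s.HeadAtSrc
  headTgt : ∀ s ∈ w.getLast?, s.HeadAtTgt

/-- The walk `w` is not blocked by `L`: every collider on it is in `L`, and no non-collider is. -/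
def Unblocked (w : List (Step V)) (L : Set V) : Prop :=
  w.IsChain fun s t => (s.Collider t → s.tgt ∈ L) ∧ (¬ s.Collider t → s.tgt ∉ L)

/-- `J` and `K` are m-connected given `L` (used for pairwise disjoint `J`, `K`, `L`). -/
def MConnected (G : MixedGraph V) (J K L : Set V) : Prop :=
  ∃ j ∈ J, ∃ k ∈ K, ∃ w, G.IsWalk w j k ∧ Unblocked w L

/-- All bidirected loops are present. -/
def IsCanonical (G : MixedGraph V) : Prop := ∀ j, G.bidir j j

/-- There is no cyclic directed walk `j → ⋯ → j`. -/
def IsAcyclic (G : MixedGraph V) : Prop := ∀ j, ¬ Relation.TransGen G.dir j j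

/-- The vertex `j` has no parents. -/
def IsExogenous (G : MixedGraph V) (j : V) : Prop := ∀ k, ¬ G.dir k j

/-- Bidirected edges, other than loops, only join exogenous vertices. -/
def IsUnconfounded (G : MixedGraph V) : Prop :=
  ∀ j k, j ≠ k → G.bidir j k → G.IsExogenous j ∧ G.IsExogenous k

/-- There are no bidirected edges other than loops. -/
def IsDirected (G : MixedGraph V) : Prop := ∀ j k, G.bidir j k → j = k

/-- The class of (canonical) acyclic directed mixed graphs. -/
def classADMG (V : Type*) : Set (MixedGraph V) := {G | G.IsCanonical ∧ G.IsAcyclic}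

/-- The class of (canonical) unconfounded acyclic directed mixed graphs. -/
def classUA (V : Type*) : Set (MixedGraph V) := {G | G ∈ classADMG V ∧ G.IsUnconfounded}

/-- The class of (canonical) directed acyclic graphs. -/
def classDAG (V : Type*) : Set (MixedGraph V) := {G | G ∈ classADMG V ∧ G.IsDirected}

theorem IsWalk.vertices {G : MixedGraph V} {w : List (Step V)} {j k : V} (h : G.IsWalk w j k) :
    j :: w.map Step.tgt = w.map Step.src ++ [k] := by
  induction w generalizing j with
  | nil => obtain ⟨s, hs, -⟩ := h.head; simp at hs
  | cons a t ih =>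
    obtain ⟨s, hs, hsj⟩ := h.head
    obtain rfl : a = s := by simpa using hs
    obtain ⟨l, hl, hlk⟩ := h.last
    cases t with
    | nil =>
      obtain rfl : a = l := by simpa using hl
      simp [hsj, hlk]
    | cons b t =>
      have hc := List.isChain_cons_cons.1 h.connected
      have := ih (j := a.tgt) ⟨fun s hs => h.isEdgeOf s (List.mem_cons_of_mem _ hs), hc.2,
        ⟨b, by simp, hc.1.symm⟩, ⟨l, by simpa using hl, hlk⟩⟩
      rw [List.map_cons, this, List.map_cons (l := b :: t), hsj, List.cons_append]

theorem IsWalk.reverse {G : MixedGraph V} {w : List (Step V)} {j k : V} (h : G.IsWalk w j k) :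
    G.IsWalk (w.map Step.rev).reverse k j where
  isEdgeOf s hs := by
    obtain ⟨t, ht, rfl⟩ : ∃ t ∈ w, t.rev = s := by simpa using hs
    exact Step.isEdgeOf_rev (h.isEdgeOf t ht)
  connected := by
    rw [List.isChain_reverse, List.isChain_map]
    exact h.connected.imp fun s t hst => hst.symm
  head := by
    obtain ⟨l, hl, hlk⟩ := h.last
    exact ⟨l.rev, by simpa using ⟨l, hl, rfl⟩, hlk⟩
  last := by
    obtain ⟨l, hl, hlk⟩ := h.head
    exact ⟨l.rev, by simpa using ⟨l, hl, rfl⟩, hlk⟩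

theorem IsConfoundingArc.reverse {G : MixedGraph V} {w : List (Step V)} {j k : V}
    (h : G.IsConfoundingArc w j k) : G.IsConfoundingArc (w.map Step.rev).reverse k j where
  toIsWalk := h.toIsWalk.reverse
  nodup := by
    have hv := h.nodup
    rw [h.toIsWalk.vertices, ← List.nodup_reverse] at hv
    simpa [List.map_map, Function.comp_def, Step.rev] using hv
  noCollider := by
    rw [List.isChain_reverse, List.isChain_map]
    refine h.noCollider.imp fun s t hst hc => hst ?_
    exact ⟨(Step.headAtSrc_rev s).1 hc.2, (Step.headAtTgt_rev t).1 hc.1⟩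
  headSrc s hs := by
    obtain ⟨t, ht, rfl⟩ : ∃ t ∈ w.getLast?, t.rev = s := by simpa using hs
    exact (Step.headAtSrc_rev t).2 (h.headTgt t ht)
  headTgt s hs := by
    obtain ⟨t, ht, rfl⟩ : ∃ t ∈ w.head?, t.rev = s := by simpa using hs
    exact (Step.headAtTgt_rev t).2 (h.headSrc t ht)

theorem IsWalk.noInner_reverse {G : MixedGraph V} {w : List (Step V)} {j k : V}
    (h : G.IsWalk w j k) {J : Set V} (hJ : NoInner w J) :
    NoInner (w.map Step.rev).reverse J := by
  have hv := h.vertices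
  intro s hs
  have hs' : s ∈ (w.map Step.rev).tail := by simpa [List.dropLast_reverse] using hs
  cases w with
  | nil => simp at hs'
  | cons a t =>
    have hv' : (a :: t).map Step.tgt = t.map Step.src ++ [k] := by simpa using (List.cons.inj hv).2
    have hd : (a :: t).dropLast.map Step.tgt = t.map Step.src := by
      rw [List.map_dropLast, hv', List.dropLast_concat]
    obtain ⟨b, hb, rfl⟩ : ∃ b ∈ t, b.rev = s := by simpa using hs'
    have hm : b.src ∈ (a :: t).dropLast.map Step.tgt := hd ▸ List.mem_map_of_mem hb
    obtain ⟨c, hc, hcb⟩ := List.mem_map.1 hm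
    have hcJ := hJ c hc
    rwa [hcb] at hcJ

/-- The marginal (latent projection) of `G` on the vertex set `U`, viewed as a subset of `V`
through the injection `ι`. -/
def marg {U : Type*} (ι : U ↪ V) (G : MixedGraph V) : MixedGraph U where
  dir j k := j ≠ k ∧ ∃ w, G.IsDirectedPath w (ι j) (ι k) ∧ NoInner w (Set.range ι)
  bidir j k := j = k ∨ ∃ w, G.IsConfoundingArc w (ι j) (ι k) ∧ NoInner w (Set.range ι)
  bidir_symm j k := by
    rintro (h | ⟨w, hw, hJ⟩)
    · exact .inl h.symm
    · exact .inr ⟨_, hw.reverse, hw.toIsWalk.noInner_reverse hJ⟩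

/-- The bidirected cliques of `G`: the sets of vertices any two of which (equal or not) are joined
by a bidirected edge. -/
def Clique (G : MixedGraph V) : Type _ := {C : Finset V // ∀ j ∈ C, ∀ k ∈ C, G.bidir j k}

noncomputable instance [Fintype V] (G : MixedGraph V) : Fintype G.Clique :=
  haveI : Finite G.Clique := Subtype.finite
  Fintype.ofFinite _

/-- The clique expansion graph of `G`: every bidirected clique is replaced by a latent common
parent. The bidirected loops are kept. -/
def cliqueExpansion (G : MixedGraph V) : MixedGraph (V ⊕ G.Clique) where
  dir x y := match x, y with
    | .inl j, .inl k => G.dir j k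
    | .inr C, .inl j => j ∈ C.1
    | _, .inr _ => False
  bidir x y := x = y
  bidir_symm _ _ h := h.symm

end MixedGraph

/-! ### State spaces and statistical models -/

/-- The state spaces after adding latent vertices `W`, each with state space `[0,1]`. -/
abbrev ExpandSpace {V : Type*} (X : V → Type) (W : Type*) : V ⊕ W → Type
  | .inl v => X v
  | .inr _ => unitInterval

instance {V W : Type*} (X : V → Type) [mX : ∀ v, MeasurableSpace (X v)] :
    ∀ i, MeasurableSpace (ExpandSpace X W i)
  | .inl v => mX v
  | .inr _ => inferInstanceAs (MeasurableSpace unitInterval)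

/-- The reference measures after adding latent vertices: Lebesgue measure on each `[0,1]`. -/
noncomputable def expandMeasure {V : Type*} {X : V → Type} [∀ v, MeasurableSpace (X v)]
    (μ : ∀ v, Measure (X v)) (W : Type*) : ∀ i, Measure (ExpandSpace X W i)
  | .inl v => μ v
  | .inr _ => (volume : Measure unitInterval)

/-- The `V`-marginal of a distribution on the expanded state space. -/
noncomputable def margDist {V W : Type*} {X : V → Type} [∀ v, MeasurableSpace (X v)]
    (P : Measure (∀ i, ExpandSpace X W i)) : Measure (∀ v, X v) :=
  P.map fun x v => x (Sum.inl v)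

section Models

variable {V : Type*} [Fintype V] {X : V → Type} [∀ v, MeasurableSpace (X v)]

/-- The probability distributions on the product space that have a density function with respect
to the product of the reference measures. -/
def distributions (μ : ∀ v, Measure (X v)) : Set (Measure (∀ v, X v)) :=
  {P | IsProbabilityMeasure P ∧ ∃ p : (∀ v, X v) → ℝ≥0∞, Measurable p ∧
    P = (Measure.pi μ).withDensity p}

open Classical in
/-- The marginal density of the coordinates in `S` under `P`, as a function on the whole product
space that depends on the coordinates in `S` only: the other coordinates of the density of `P`
are integrated out. -/
noncomputable def marginalDensity (μ : ∀ v, Measure (X v)) (P : Measure (∀ v, X v))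
    (S : Finset V) : (∀ v, X v) → ℝ≥0∞ :=
  lmarginal μ Sᶜ (P.rnDeriv (Measure.pi μ))

open Classical in
/-- Conditional independence of `J` and `K` given `L` under `P`, in terms of the conditional
densities: `p(v_J, v_K | v_L) = p(v_J | v_L) p(v_K | v_L)` wherever `p(v_L) > 0`. Densities are
only determined almost everywhere, so this is required almost everywhere. -/
def CondIndepGiven (μ : ∀ v, Measure (X v)) (P : Measure (∀ v, X v)) (J K L : Finset V) : Prop :=
  ∀ᵐ x ∂Measure.pi μ, 0 < marginalDensity μ P L x →
    marginalDensity μ P (J ∪ K ∪ L) x / marginalDensity μ P L x =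
      (marginalDensity μ P (J ∪ L) x / marginalDensity μ P L x) *
        (marginalDensity μ P (K ∪ L) x / marginalDensity μ P L x)

namespace MixedGraph

/-- The global Markov model. -/
def globalMarkovModel (G : MixedGraph V) (μ : ∀ v, Measure (X v)) : Set (Measure (∀ v, X v)) :=
  {P | P ∈ distributions μ ∧ ∀ J K L : Finset V, Disjoint J K → Disjoint J L → Disjoint K L →
    ¬ G.MConnected J K L → CondIndepGiven μ P J K L}

/-- The clique expansion model: the `V`-marginals of the global Markov model of the clique
expansion graph, all latent variables having state space `[0,1]`. -/
def CEModel (G : MixedGraph V) (μ : ∀ v, Measure (X v)) : Set (Measure (∀ v, X v)) :=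
  margDist '' G.cliqueExpansion.globalMarkovModel (expandMeasure μ G.Clique)

end MixedGraph

end Models

namespace MixedGraph

/-- The union, over all finite sets `W` of additional latent vertices and all graphs `G'` on
`V ∪ W` in the class `𝒢 (V ∪ W)` whose `V`-marginal is `G`, of the `V`-marginals of the clique expansion
models of `G'`, the latent variables in `W` having state space `[0,1]`. -/
def unionOfExpandedCEModels {V : Type u} [Fintype V] {X : V → Type}
    [∀ v, MeasurableSpace (X v)] (𝒢 : ∀ V' : Type u, Set (MixedGraph V')) (G : MixedGraph V)
    (μ : ∀ v, Measure (X v)) : Set (Measure (∀ v, X v)) :=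
  ⋃ (W : Type u) (_ : Fintype W),
    ⋃ G' ∈ {G' : MixedGraph (V ⊕ W) | G' ∈ 𝒢 (V ⊕ W) ∧ G'.marg Function.Embedding.inl = G},
      margDist '' G'.CEModel (expandMeasure μ W)

end MixedGraph

/-!
The easy inclusions come from the clique expansion `D` of `G`: it is a DAG whose marginal graph is
`G` (`marg_cliqueExpansion`), and the global Markov model of a DAG is contained in its clique
expansion model (`globalMarkovModel_subset_CEModel`), because the additional latent variables may
be ignored. The substance is the converse (`margDist_image_CEModel_subset`): if `G` is the marginal
graph of an ADMG `G'`, then the margins of the distributions in the clique expansion model of `G'`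
lie in the clique expansion model of `G`.

Two facts connect the Markov property with densities. A distribution that is globally Markov with
respect to a DAG has as density the product of conditional densities of the vertices given their
parents (`exists_isCondDensities`), since the parents of a vertex separate it from the other
vertices that precede it. Conversely, every such product is globally Markov
(`IsCondDensities.mem_globalMarkovModel`): a set of vertices that is not m-connected to another one
splits the product over the ancestors into two factors.

Now let `Q` be globally Markov with respect to the clique expansion of `G'`. All latent variables
take values in `[0,1]`, so each of them is a function of its parents and of an independent uniform
noise variable. Solving these equations along a topological order (`solve`, `lintegral_solve`)
expresses every latent variable through the observed variables and the noise. The conditional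
density of an observed vertex `v` then depends on the observed vertices that reach `v` by directed
walks through latent vertices, which are the parents of `v` in the marginal graph, and on the noise
of the latent vertices that reach `v` in this way. The observed vertices reached from one latent
vertex form a bidirected clique of the marginal graph (`marg_bidir_of_common`), so that its noise
can be assigned to this clique. The noise variables assigned to the same clique are finally
generated from a single uniform variable (`exists_measurePreserving_regroup`). The result is a
product of conditional densities along the clique expansion of `G`.

For acyclic graphs, a rank function `r` that increases along directed edges replaces topological
orders throughout.
-/

/-! ### Marginal integrals -/

section Marginal

variable {I : Type*} [DecidableEq I] {Y : I → Type*}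

theorem DependsOn.comp_update {β : Type*} {f : (∀ i, Y i) → β} {s : Set I} (hf : DependsOn f s)
    {i : I} (hi : i ∉ s) (x : ∀ i, Y i) (y : Y i) : f (Function.update x i y) = f x :=
  hf fun j hj => Function.update_of_ne (by rintro rfl; exact hi hj) _ _

theorem DependsOn.comp_updateFinset {β : Type*} {f : (∀ i, Y i) → β} {s : Set I}
    (hf : DependsOn f s) {t : Finset I} (ht : Disjoint s t) (x : ∀ i, Y i) (y : ∀ i : t, Y i) :
    f (Function.updateFinset x t y) = f x :=
  hf fun j hj => by
    have : j ∉ t := fun h => Set.disjoint_left.1 ht hj h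
    simp [Function.updateFinset_def, this]

variable [∀ i, MeasurableSpace (Y i)]

theorem Measurable.comp_updateFinset {β : Type*} [MeasurableSpace β] {f : (∀ i, Y i) → β}
    (hf : Measurable f) (x : ∀ i, Y i) (s : Finset I) :
    Measurable fun y : ∀ i : s, Y i => f (Function.updateFinset x s y) :=
  hf.comp measurable_updateFinset

theorem DependsOn.lmarginal {f : (∀ i, Y i) → ℝ≥0∞} {t : Set I} (hf : DependsOn f t)
    (μ : ∀ i, Measure (Y i)) (s : Finset I) : DependsOn (lmarginal μ s f) (t \ s) := by
  intro x y hxy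
  simp only [MeasureTheory.lmarginal]
  refine lintegral_congr fun z => hf fun i hi => ?_
  by_cases his : i ∈ s
  · simp [Function.updateFinset_def, his]
  · simpa [Function.updateFinset_def, his] using hxy i ⟨hi, his⟩

theorem dependsOn_lmarginal (μ : ∀ i, Measure (Y i)) (s : Finset I) (f : (∀ i, Y i) → ℝ≥0∞) :
    DependsOn (lmarginal μ s f) (↑s)ᶜ :=
  fun _ _ h => lmarginal_congr μ f fun i hi => h i hi

theorem lmarginal_mul_left (μ : ∀ i, Measure (Y i)) {s : Finset I} {f g : (∀ i, Y i) → ℝ≥0∞}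
    {t : Set I} (hf : DependsOn f t) (hts : Disjoint t s) (hg : Measurable g) :
    lmarginal μ s (fun x => f x * g x) = fun x => f x * lmarginal μ s g x := by
  ext x
  simp only [lmarginal]
  rw [← lintegral_const_mul _ (hg.comp_updateFinset x s)]
  exact lintegral_congr fun y => by rw [hf.comp_updateFinset hts]

theorem lmarginal_mul_right (μ : ∀ i, Measure (Y i)) {s : Finset I} {f g : (∀ i, Y i) → ℝ≥0∞}
    {t : Set I} (hg : DependsOn g t) (hts : Disjoint t s) (hf : Measurable f) :
    lmarginal μ s (fun x => f x * g x) = fun x => lmarginal μ s f x * g x := by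
  simp only [mul_comm _ (g _)]
  exact lmarginal_mul_left μ hg hts hf

theorem lmarginal_eq_self (μ : ∀ i, Measure (Y i)) {s : Finset I}
    (hs : ∀ i ∈ s, IsProbabilityMeasure (μ i)) {f : (∀ i, Y i) → ℝ≥0∞}
    {t : Set I} (hf : DependsOn f t) (hts : Disjoint t s) : lmarginal μ s f = f := by
  ext x
  have : ∀ i : s, IsProbabilityMeasure (μ i) := fun i => hs i i.2
  simp only [lmarginal, hf.comp_updateFinset hts]
  simp

variable (μ : ∀ i, Measure (Y i)) [∀ i, SigmaFinite (μ i)]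

theorem lmarginal_union_mul {s t : Finset I} (hst : Disjoint s t) {f g : (∀ i, Y i) → ℝ≥0∞}
    {a b : Set I} (hf : DependsOn f a) (hat : Disjoint a t) (hg : DependsOn g b)
    (hbs : Disjoint b s) (hfm : Measurable f) (hgm : Measurable g) :
    lmarginal μ (s ∪ t) (fun x => f x * g x) =
      fun x => lmarginal μ s f x * lmarginal μ t g x := by
  rw [lmarginal_union μ (fun x => f x * g x) (hfm.mul hgm) hst, lmarginal_mul_left μ hf hat hgm]
  exact lmarginal_mul_right μ (hg.lmarginal μ t) (hbs.mono_left Set.sdiff_subset) hfm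

variable [Fintype I]

/-- A measurable property holds almost everywhere if it holds almost everywhere on every slice. -/
theorem ae_pi_of_forall_ae_updateFinset (s : Finset I) {p : (∀ i, Y i) → Prop}
    (hp : MeasurableSet {x | p x})
    (h : ∀ x, ∀ᵐ y ∂Measure.pi fun i : s => μ i, p (Function.updateFinset x s y)) :
    ∀ᵐ x ∂Measure.pi μ, p x := by
  have hm : Measurable ({x | p x}ᶜ.indicator (1 : (∀ i, Y i) → ℝ≥0∞)) :=
    measurable_one.indicator hp.compl
  have : ∫⁻ x, {x | p x}ᶜ.indicator (1 : (∀ i, Y i) → ℝ≥0∞) x ∂Measure.pi μ =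
      ∫⁻ x, (0 : (∀ i, Y i) → ℝ≥0∞) x ∂Measure.pi μ := by
    refine lintegral_eq_of_lmarginal_eq s hm measurable_zero ?_
    ext x
    simp only [lmarginal]
    refine lintegral_congr_ae ?_
    filter_upwards [h x] with y hy
    simp [hy]
  rw [lintegral_indicator hp.compl] at this
  simpa [ae_iff, Set.compl_ofPred] using this

/-- If a measurable property holds almost everywhere, it does so on almost every slice. -/
theorem ae_ae_updateFinset_of_ae_pi (s : Finset I) {p : (∀ i, Y i) → Prop}
    (hp : MeasurableSet {x | p x}) (h : ∀ᵐ x ∂Measure.pi μ, p x) :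
    ∀ᵐ x ∂Measure.pi μ, ∀ᵐ y ∂Measure.pi fun i : s => μ i, p (Function.updateFinset x s y) := by
  set q : (∀ i, Y i) → ℝ≥0∞ := {x | p x}ᶜ.indicator 1 with hq
  have hm : Measurable q := measurable_one.indicator hp.compl
  have key : ∀ x, lmarginal μ s q x = 0 →
      ∀ᵐ y ∂Measure.pi fun i : s => μ i, p (Function.updateFinset x s y) := by
    intro x hx
    simp only [lmarginal] at hx
    rw [lintegral_eq_zero_iff (hm.comp_updateFinset x s)] at hx
    filter_upwards [hx] with y hy
    simpa [hq, Set.indicator_apply] using hy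
  have h0 : ∀ᵐ x ∂Measure.pi μ, lmarginal μ s q x = 0 := by
    refine ae_pi_of_forall_ae_updateFinset μ sᶜ
      ((hm.lmarginal μ) (measurableSet_singleton 0)) fun x => ?_
    have : lmarginal μ sᶜ (lmarginal μ s q) x = 0 := by
      rw [← lmarginal_union μ q hm disjoint_compl_left, Finset.union_comm, Finset.union_compl,
        ← lintegral_eq_lmarginal_univ, hq, lintegral_indicator hp.compl]
      simpa [ae_iff, Set.compl_ofPred] using h
    exact (lintegral_eq_zero_iff ((hm.lmarginal μ).comp measurable_updateFinset)).1 this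
  filter_upwards [h0] with x hx using key x hx

theorem lmarginal_congr_ae (s : Finset I) {f g : (∀ i, Y i) → ℝ≥0∞} (hf : Measurable f)
    (hg : Measurable g) (h : f =ᵐ[Measure.pi μ] g) :
    lmarginal μ s f =ᵐ[Measure.pi μ] lmarginal μ s g := by
  filter_upwards [ae_ae_updateFinset_of_ae_pi μ s (measurableSet_eq_fun hf hg) h] with x hx
  exact lintegral_congr_ae hx

theorem lmarginal_compl_lmarginal (s : Finset I) {f : (∀ i, Y i) → ℝ≥0∞} (hf : Measurable f)
    (x : ∀ i, Y i) : lmarginal μ sᶜ (lmarginal μ s f) x = ∫⁻ x, f x ∂Measure.pi μ := by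
  rw [← lmarginal_union μ f hf disjoint_compl_left, Finset.union_comm, Finset.union_compl,
    ← lintegral_eq_lmarginal_univ]

theorem ae_lmarginal_lt_top (s : Finset I) {f : (∀ i, Y i) → ℝ≥0∞} (hf : Measurable f)
    (h : ∫⁻ x, f x ∂Measure.pi μ ≠ ∞) : ∀ᵐ x ∂Measure.pi μ, lmarginal μ s f x < ∞ := by
  refine ae_pi_of_forall_ae_updateFinset μ sᶜ
    (measurableSet_lt (hf.lmarginal μ) measurable_const) fun x => ?_
  refine ae_lt_top ((hf.lmarginal μ).comp measurable_updateFinset) ?_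
  have := lmarginal_compl_lmarginal μ s hf x
  rw [lmarginal] at this
  rwa [← this] at h

theorem lmarginal_sdiff_lmarginal_compl {s t : Finset I} (hst : s ⊆ t) {f : (∀ i, Y i) → ℝ≥0∞}
    (hf : Measurable f) : lmarginal μ (t \ s) (lmarginal μ tᶜ f) = lmarginal μ sᶜ f := by
  rw [← lmarginal_union μ f hf]
  · congr 1
    ext i
    have := @hst i
    simp only [Finset.mem_union, Finset.mem_sdiff, Finset.mem_compl]
    tauto
  · exact Finset.disjoint_left.2 fun i hi hi' => by simp_all

/-- Almost everywhere, a joint marginal density vanishes where a smaller one does. -/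
theorem ae_lmarginal_compl_eq_zero {s t : Finset I} (hst : s ⊆ t) {f : (∀ i, Y i) → ℝ≥0∞}
    (hf : Measurable f) :
    ∀ᵐ x ∂Measure.pi μ, lmarginal μ sᶜ f x = 0 → lmarginal μ tᶜ f x = 0 := by
  have hz : ∀ a : Finset I, MeasurableSet {x | lmarginal μ aᶜ f x = 0} := fun a =>
    (hf.lmarginal μ) (measurableSet_singleton 0)
  refine ae_pi_of_forall_ae_updateFinset μ (t \ s)
    (p := fun x => lmarginal μ sᶜ f x = 0 → lmarginal μ tᶜ f x = 0) ?_ fun x => ?_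
  · simp only [imp_iff_not_or]
    exact (hz s).compl.union (hz t)
  · by_cases hx : lmarginal μ sᶜ f x = 0
    · rw [← lmarginal_sdiff_lmarginal_compl μ hst hf, lmarginal,
        lintegral_eq_zero_iff ((hf.lmarginal μ).comp_updateFinset x _)] at hx
      filter_upwards [hx] with y hy _ using hy
    · refine Filter.Eventually.of_forall fun y h => (hx ?_).elim
      rwa [(dependsOn_lmarginal μ sᶜ f).comp_updateFinset] at h
      exact Set.disjoint_left.2 fun i hi hi' => by simp_all

end Marginal

/-! ### m-separation in graphs without confounding -/

namespace MixedGraph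

variable {I : Type*} {D : MixedGraph I}

theorem IsWalk.concat {w : List (Step I)} {j : I} {s : Step I} (h : D.IsWalk w j s.src)
    (hs : s.IsEdgeOf D) : D.IsWalk (w ++ [s]) j s.tgt where
  isEdgeOf t ht := by
    rcases List.mem_append.1 ht with ht | ht
    · exact h.isEdgeOf t ht
    · obtain rfl : t = s := by simpa using ht
      exact hs
  connected := by
    obtain ⟨l, hl, hls⟩ := h.last
    refine List.isChain_append.2 ⟨h.connected, List.isChain_singleton s, fun x hx y hy => ?_⟩
    obtain rfl : l = x := Option.mem_unique hl hx
    obtain rfl : s = y := by simpa using hy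
    exact hls
  head := by
    obtain ⟨a, ha, haj⟩ := h.head
    exact ⟨a, List.mem_head?_append_of_mem_head? ha, haj⟩
  last := ⟨s, by simp, rfl⟩

/-- The vertex `v` can be reached from `J` by a walk that is not blocked by `L`; the proposition
`h` tells whether the last edge of the walk has an arrowhead at `v`. Vertices of `J` count as
reached by the trivial walk, without an arrowhead. -/
def Reach (D : MixedGraph I) (J L : Set I) (h : Prop) (v : I) : Prop :=
  (¬ h ∧ v ∈ J) ∨ ∃ j ∈ J, ∃ w, D.IsWalk w j v ∧ Unblocked w L ∧
    ∀ s ∈ w.getLast?, (s.HeadAtTgt ↔ h)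

theorem Reach.step {J L : Set I} {h : Prop} {s : Step I} (hv : D.Reach J L h s.src)
    (hs : s.IsEdgeOf D) (hc : h ∧ s.HeadAtSrc → s.src ∈ L)
    (hnc : ¬ (h ∧ s.HeadAtSrc) → s.src ∉ L) : D.Reach J L s.HeadAtTgt s.tgt := by
  rcases hv with ⟨-, hv⟩ | ⟨j, hj, w, hw, hu, hl⟩
  · refine .inr ⟨_, hv, [s], ⟨by simpa using hs, List.isChain_singleton s, ⟨s, by simp, rfl⟩,
      ⟨s, by simp, rfl⟩⟩, List.isChain_singleton s, by simp⟩
  · refine .inr ⟨j, hj, w ++ [s], hw.concat hs, ?_, by simp⟩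
    obtain ⟨l, hlw, hls⟩ := hw.last
    refine List.isChain_append.2 ⟨hu, List.isChain_singleton s, fun x hx y hy => ?_⟩
    obtain rfl : l = x := Option.mem_unique hlw hx
    obtain rfl : s = y := by simpa using hy
    rw [hls, Step.Collider, hl l hx]
    exact ⟨hc, hnc⟩

theorem Reach.child {J L : Set I} {h : Prop} {v c : I} (hv : D.Reach J L h v) (hvL : v ∉ L)
    (hc : D.dir v c) : D.Reach J L True c := by
  have := Reach.step (s := ⟨v, c, .right⟩) hv hc (by simp [Step.HeadAtSrc]) fun _ => hvL
  simpa [Step.HeadAtTgt] using this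

theorem Reach.parent {J L : Set I} {v u : I} (hv : D.Reach J L False v) (hvL : v ∉ L)
    (hu : D.dir u v) : D.Reach J L False u := by
  have := Reach.step (s := ⟨v, u, .left⟩) hv hu (by simp) fun _ => hvL
  simpa [Step.HeadAtTgt] using this

theorem Reach.parent_of_mem {J L : Set I} {v u : I} (hv : D.Reach J L True v) (hvL : v ∈ L)
    (hu : D.dir u v) : D.Reach J L False u := by
  have := Reach.step (s := ⟨v, u, .left⟩) hv hu (fun _ => hvL) (by simp [Step.HeadAtSrc])
  simpa [Step.HeadAtTgt] using this

theorem Reach.mConnected {J K L : Set I} {h : Prop} {v : I} (hv : D.Reach J L h v) (hvK : v ∈ K)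
    (hJK : Disjoint J K) : D.MConnected J K L := by
  rcases hv with ⟨-, hv⟩ | ⟨j, hj, w, hw, hu, -⟩
  · exact (Set.disjoint_left.1 hJK hv hvK).elim
  · exact ⟨j, hj, v, hvK, w, hw, hu⟩

/-- The ancestors of the vertices in `T`, including these vertices. -/
def ancestors (D : MixedGraph I) (T : Set I) : Set I :=
  {v | ∃ t ∈ T, Relation.ReflTransGen D.dir v t}

/-- If `v` is an ancestor of `J ∪ K ∪ L` outside `L`, then a walk that arrives at `v` through an
arrowhead can be extended to one that arrives without: it runs down a directed path from `v` until
it hits `L` and back up again. If the path hits `J` first, then `v` can be reached from there. -/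
theorem Reach.up {J K L : Set I} (hJK : Disjoint J K)
    (hn : ¬ D.MConnected J K L) {v : I} (hv : D.Reach J L True v) (hvL : v ∉ L)
    (hA : v ∈ D.ancestors (J ∪ K ∪ L)) : D.Reach J L False v := by
  obtain ⟨t, ht, hvt⟩ := hA
  induction hvt using Relation.ReflTransGen.head_induction_on with
  | refl =>
    rcases ht with (ht | ht) | ht
    · exact .inl ⟨id, ht⟩
    · exact (hn (hv.mConnected ht hJK)).elim
    · exact (hvL ht).elim
  | @head a c hac _ ih =>
    have hc := hv.child hvL hac
    by_cases hcL : c ∈ L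
    · exact hc.parent_of_mem hcL hac
    · exact (ih hc hcL).parent hcL hac

/-- Vertices that belong to a common family (a child `c` with its parents) among the ancestors
of `J ∪ K ∪ L` are not separated by `L` from one another. -/
theorem Reach.of_family {J K L : Set I} (hJK : Disjoint J K)
    (hn : ¬ D.MConnected J K L) {v u c : I} (hv : D.Reach J L False v)
    (hvL : v ∉ L) (hc : c ∈ D.ancestors (J ∪ K ∪ L)) (hvc : v = c ∨ D.dir v c)
    (huc : u = c ∨ D.dir u c) (huL : u ∉ L) : D.Reach J L False u := by
  have hup : c ∉ L → D.Reach J L False c := by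
    intro hcL
    rcases hvc with rfl | hvc
    · exact hv
    · exact (hv.child hvL hvc).up hJK hn hcL hc
  rcases huc with rfl | huc
  · exact hup huL
  · by_cases hcL : c ∈ L
    · rcases hvc with rfl | hvc
      · exact (hvL hcL).elim
      · exact (hv.child hvL hvc).parent_of_mem hcL huc
    · exact (hup hcL).parent hcL huc

/-- An unblocked walk that leaves a descendant of `a` through a tail, or through a loop, only meets
descendants of `a`: a collider on it would be a descendant of `a` and a parent of `a`. -/
theorem descendant_of_isWalk {r : I → ℕ} (hr : ∀ i j, D.dir i j → r i < r j)
    (hD : D.IsDirected) {a k : I} : ∀ {w : List (Step I)} {u : I}, D.IsWalk w u k →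
    Unblocked w {p | D.dir p a} → Relation.ReflTransGen D.dir a u →
    (∀ s ∈ w.head?, s.type ≠ .left) → Relation.ReflTransGen D.dir a k
  | [], u, hw, _, _, _ => by obtain ⟨s, hs, -⟩ := hw.head; simp at hs
  | s :: w, u, hw, hu, hau, hs => by
    have hle : ∀ {b}, Relation.ReflTransGen D.dir a b → r a ≤ r b := by
      intro b hb
      induction hb with
      | refl => exact le_rfl
      | tail _ h ih => exact ih.trans (hr _ _ h).le
    obtain ⟨s', hs', hsu⟩ := hw.head
    obtain rfl : s = s' := by simpa using hs'
    have hse := hw.isEdgeOf s (by simp)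
    have hst := hs s (by simp)
    have hat : Relation.ReflTransGen D.dir a s.tgt ∧ s.HeadAtTgt := by
      obtain ⟨b, c, t⟩ := s
      obtain rfl : b = u := hsu
      cases t with
      | right => exact ⟨hau.tail hse, .inl rfl⟩
      | left => exact (hst rfl).elim
      | bi => exact ⟨hD _ _ hse ▸ hau, .inr rfl⟩
    cases w with
    | nil =>
      obtain ⟨l, hl, hlk⟩ := hw.last
      obtain rfl : s = l := by simpa using hl
      exact hlk ▸ hat.1
    | cons t w =>
      have hch := List.isChain_cons_cons.1 hw.connected
      have huh := List.isChain_cons_cons.1 hu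
      refine descendant_of_isWalk hr hD (w := t :: w) (u := s.tgt)
        ⟨fun x hx => hw.isEdgeOf x (List.mem_cons_of_mem _ hx), hch.2, ⟨t, by simp, hch.1.symm⟩,
          by simpa using hw.last⟩ huh.2 hat.1 fun x hx hxl => ?_
      obtain rfl : t = x := by simpa using hx
      have hp : D.dir s.tgt a := huh.1.1 ⟨hat.2, .inl hxl⟩
      exact absurd (hr _ _ hp) (hle hat.1).not_gt

/-- The parents of `a` separate `a` from its other non-descendants. -/
theorem not_mConnected_parents {r : I → ℕ} (hr : ∀ i j, D.dir i j → r i < r j)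
    (hD : D.IsDirected) {a : I} {K : Set I} (haK : a ∉ K) (hK : ∀ k ∈ K, r k ≤ r a)
    (hKp : ∀ k ∈ K, ¬ D.dir k a) : ¬ D.MConnected {a} K {p | D.dir p a} := by
  rintro ⟨j, rfl, k, hk, w, hw, hu⟩
  have hdesc : Relation.ReflTransGen D.dir j k := by
    refine descendant_of_isWalk hr hD hw hu .refl fun s hs hsl => ?_
    obtain ⟨s', hs', hsj⟩ := hw.head
    obtain rfl : s = s' := Option.mem_unique hs hs'
    have hse := hw.isEdgeOf s (List.mem_of_head? hs)
    have hp : D.dir s.tgt j := by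
      obtain ⟨b, c, t⟩ := s
      obtain rfl : t = .left := hsl
      obtain rfl : b = j := hsj
      exact hse
    match w, hs with
    | [_], rfl =>
      obtain ⟨l, hl, hlk⟩ := hw.last
      obtain rfl : s = l := by simpa using hl
      exact hKp k hk (hlk ▸ hp)
    | _ :: t :: w, rfl =>
      exact ((List.isChain_cons_cons.1 hu).1.2 (by simp [Step.Collider, Step.HeadAtTgt, hsl])) hp
  rcases hdesc.cases_tail with h | ⟨c, hc, hck⟩
  · exact haK (h ▸ hk)
  · have hle : r j ≤ r c := by
      clear hck
      induction hc with
      | refl => exact le_rfl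
      | tail _ h ih => exact ih.trans (hr _ _ h).le
    exact absurd (hle.trans_lt (hr _ _ hck)) (hK k hk).not_gt

end MixedGraph

/-! ### Markov factorizations -/

section Factorization

variable {I : Type*} {Y : I → Type}

theorem DependsOn.finset_prod {k : I → (∀ i, Y i) → ℝ≥0∞} {T : Finset I} {s : Set I}
    (h : ∀ i ∈ T, DependsOn (k i) s) : DependsOn (fun x => ∏ i ∈ T, k i x) s :=
  fun _ _ hxy => Finset.prod_congr rfl fun i hi => h i hi hxy

variable [∀ i, MeasurableSpace (Y i)]

open Classical in
/-- `k i` is, for every vertex `i`, a version of the conditional density of the coordinate `i`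
given its parents, as a function on the whole product space. -/
structure MixedGraph.IsCondDensities (D : MixedGraph I) (μ : ∀ i, Measure (Y i))
    (k : I → (∀ i, Y i) → ℝ≥0∞) : Prop where
  measurable : ∀ i, Measurable (k i)
  dependsOn : ∀ i, DependsOn (k i) (insert i {j | D.dir j i})
  lintegral_eq_one : ∀ i x, ∫⁻ t, k i (Function.update x i t) ∂μ i = 1

/-- The defining normalization, for an arbitrary instance of decidable equality. -/
theorem MixedGraph.IsCondDensities.lintegral_update [DecidableEq I] {D : MixedGraph I}
    {μ : ∀ i, Measure (Y i)} {k : I → (∀ i, Y i) → ℝ≥0∞} (hk : D.IsCondDensities μ k) (i : I)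
    (x : ∀ i, Y i) : ∫⁻ t, k i (Function.update x i t) ∂μ i = 1 := by
  convert hk.lintegral_eq_one i x

variable [Fintype I] (μ : ∀ i, Measure (Y i)) [∀ i, SigmaFinite (μ i)]

open Classical in
/-- Integrating out a set of vertices that is closed under taking children removes their
conditional densities from the product. -/
theorem MixedGraph.IsCondDensities.lmarginal_prod {D : MixedGraph I} {r : I → ℕ}
    (hr : ∀ i j, D.dir i j → r i < r j) {k : I → (∀ i, Y i) → ℝ≥0∞}
    (hk : D.IsCondDensities μ k) (S : Finset I) (hS : ∀ i ∈ S, ∀ j, D.dir i j → j ∈ S) :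
    lmarginal μ S (fun x => ∏ i, k i x) = fun x => ∏ i ∈ Sᶜ, k i x := by
  induction S using Finset.induction_on_min_value r with
  | empty => simp
  | insert a s has hle ih =>
    have ih := ih fun i hi j hij => by
      rcases Finset.mem_insert.1 (hS i (Finset.mem_insert_of_mem hi) j hij) with rfl | h
      · exact absurd (hr _ _ hij) (hle i hi).not_gt
      · exact h
    ext x
    rw [lmarginal_insert _ (Finset.measurable_prod _ fun i _ => hk.measurable i) has, ih]
    have hc : sᶜ = insert a (insert a s)ᶜ := by
      ext i
      by_cases h : i = a
      · simp [h, has]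
      · simp [h]
    have hd : DependsOn (fun x => ∏ i ∈ (insert a s)ᶜ, k i x) {a}ᶜ :=
      DependsOn.finset_prod fun i hi => (hk.dependsOn i).mono fun j hj => by
        have hi := Finset.mem_compl.1 hi
        rcases hj with rfl | hj
        · rintro rfl
          exact hi (Finset.mem_insert_self _ _)
        · rintro rfl
          exact hi (hS _ (Finset.mem_insert_self _ _) _ hj)
    simp only [hc]
    simp only [Finset.prod_insert (show a ∉ (insert a s)ᶜ by simp)]
    simp only [hd.comp_update (show a ∉ ({a}ᶜ : Set I) by simp)]
    have hka : Measurable fun t => k a (Function.update x a t) :=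
      (hk.measurable a).comp (measurable_update x)
    rw [lintegral_mul_const _ hka,
      hk.lintegral_eq_one, one_mul]

theorem rnDeriv_withDensity_pi {p : (∀ i, Y i) → ℝ≥0∞} (hp : Measurable p) :
    ((Measure.pi μ).withDensity p).rnDeriv (Measure.pi μ) =ᵐ[Measure.pi μ] p :=
  Measure.rnDeriv_withDensity _ hp

open Classical in
/-- If the joint density of `B ∪ C ∪ L` splits into a function of `B ∪ L` and a function of
`C ∪ L`, then `L` renders `B` and `C` independent. -/
theorem condIndepGiven_of_mul {p : (∀ i, Y i) → ℝ≥0∞} (hp : Measurable p)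
    (hp1 : ∫⁻ x, p x ∂Measure.pi μ = 1)
    {B C L J K : Finset I} (hBC : Disjoint B C) (hBL : Disjoint B L) (hCL : Disjoint C L)
    (hJB : J ⊆ B) (hKC : K ⊆ C) {f g : (∀ i, Y i) → ℝ≥0∞} (hf : Measurable f) (hg : Measurable g)
    (hfd : DependsOn f (↑B ∪ ↑L)) (hgd : DependsOn g (↑C ∪ ↑L))
    (hfg : lmarginal μ (B ∪ C ∪ L)ᶜ p = fun x => f x * g x) :
    CondIndepGiven μ ((Measure.pi μ).withDensity p) J K L := by
  have hBC' := Finset.disjoint_left.1 hBC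
  have hBL' := Finset.disjoint_left.1 hBL
  have hCL' := Finset.disjoint_left.1 hCL
  have hmarg : ∀ {S s t : Finset I}, s ⊆ B → t ⊆ C → S = (B ∪ C ∪ L) \ (s ∪ t) →
      marginalDensity μ ((Measure.pi μ).withDensity p) S =ᵐ[Measure.pi μ]
        fun x => lmarginal μ s f x * lmarginal μ t g x := by
    intro S s t hs ht hS
    have h1 : lmarginal μ Sᶜ p = fun x => lmarginal μ s f x * lmarginal μ t g x := by
      have hSA : S ⊆ B ∪ C ∪ L := hS ▸ Finset.sdiff_subset
      have hst : (B ∪ C ∪ L) \ S = s ∪ t := by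
        rw [hS, Finset.sdiff_sdiff_eq_self]
        exact Finset.union_subset
          (hs.trans (Finset.subset_union_left.trans Finset.subset_union_left))
          (ht.trans (Finset.subset_union_right.trans Finset.subset_union_left))
      rw [← lmarginal_sdiff_lmarginal_compl μ hSA hp, hfg, hst]
      refine lmarginal_union_mul μ (Finset.disjoint_of_subset_left hs
        (Finset.disjoint_of_subset_right ht hBC)) hfd ?_ hgd ?_ hf hg
      · refine Set.disjoint_left.2 fun i hi hit => ?_
        rcases hi with hi | hi
        · exact hBC' hi (ht hit)
        · exact hCL' (ht hit) hi
      · refine Set.disjoint_left.2 fun i hi his => ?_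
        rcases hi with hi | hi
        · exact hBC' (hs his) hi
        · exact hBL' (hs his) hi
    have h2 := lmarginal_congr_ae μ Sᶜ (Measure.measurable_rnDeriv _ _) hp
      (rnDeriv_withDensity_pi μ hp)
    rw [h1] at h2
    exact h2
  have e : ∀ {S s t : Finset I}, (∀ i, i ∈ S ↔ i ∈ (B ∪ C ∪ L) \ (s ∪ t)) →
    S = (B ∪ C ∪ L) \ (s ∪ t) := fun h => Finset.ext h
  have hJKL := hmarg (S := J ∪ K ∪ L) (s := B \ J) (t := C \ K) Finset.sdiff_subset
    Finset.sdiff_subset <| e fun i => by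
      grind
  have hJL := hmarg (S := J ∪ L) (s := B \ J) (t := C) Finset.sdiff_subset
    subset_rfl <| e fun i => by
      grind
  have hKL := hmarg (S := K ∪ L) (s := B) (t := C \ K) subset_rfl
    Finset.sdiff_subset <| e fun i => by
      grind
  have hL := hmarg (S := L) (s := B) (t := C) subset_rfl subset_rfl <| e fun i => by
      grind
  have hfin := ae_lmarginal_lt_top μ Lᶜ hp (hp1 ▸ ENNReal.one_ne_top)
  have hL2 := lmarginal_congr_ae μ Lᶜ (Measure.measurable_rnDeriv _ _) hp
      (rnDeriv_withDensity_pi μ hp)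
  have hL3 : marginalDensity μ ((Measure.pi μ).withDensity p) L =ᵐ[Measure.pi μ]
      lmarginal μ Lᶜ p := by
    exact hL2
  filter_upwards [hJKL, hJL, hKL, hL, hfin, hL3] with x h1 h2 h3 h4 h5 h6 hpos
  rw [h4] at h6
  rw [h4] at hpos
  rw [← h6] at h5
  rw [h1, h2, h3, h4]
  -- A product in `[0, ∞]` that is positive and finite has positive and finite factors.
  have hF : lmarginal μ B f x ≠ 0 := fun h => by simp [h] at hpos
  have hG : lmarginal μ C g x ≠ 0 := fun h => by simp [h] at hpos
  have hF' : lmarginal μ B f x ≠ ∞ := fun h => by simp [h, ENNReal.top_mul hG] at h5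
  have hG' : lmarginal μ C g x ≠ ∞ := fun h => by simp [h, ENNReal.mul_top hF] at h5
  rw [ENNReal.mul_div_mul_right _ _ hG hG', ENNReal.mul_div_mul_left _ _ hF hF',
    ENNReal.mul_div_mul_comm (.inl hF) (.inl hF')]

open Classical in
/-- Soundness of m-separation: a distribution whose density is a product of conditional densities
along an acyclic graph satisfies the global Markov property. The density of the ancestors `A` of
`J ∪ K ∪ L` is the product over `A`. Let `B` consist of the vertices of `A \ L` that are reachable
from `J`. A family in `A` that meets `B` is contained in `B ∪ L`, which splits the product. -/
theorem MixedGraph.IsCondDensities.mem_globalMarkovModel {D : MixedGraph I} {r : I → ℕ}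
    (hr : ∀ i j, D.dir i j → r i < r j) {k : I → (∀ i, Y i) → ℝ≥0∞}
    (hk : D.IsCondDensities μ k) [Nonempty (∀ i, Y i)] :
    (Measure.pi μ).withDensity (fun x => ∏ i, k i x) ∈ D.globalMarkovModel μ := by
  have hm : Measurable fun x => ∏ i, k i x := Finset.measurable_prod _ fun i _ => hk.measurable i
  have h1 : ∫⁻ x, ∏ i, k i x ∂Measure.pi μ = 1 := by
    obtain ⟨x⟩ := ‹Nonempty (∀ i, Y i)›
    rw [lintegral_eq_lmarginal_univ x, hk.lmarginal_prod μ hr _ (by simp)]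
    simp
  refine ⟨⟨⟨by rw [withDensity_apply _ .univ, setLIntegral_univ, h1]⟩, _, hm, rfl⟩, ?_⟩
  intro J K L hJK hJL hKL hn
  have hJK' : Disjoint (J : Set I) K := Finset.disjoint_coe.2 hJK
  set A : Set I := D.ancestors (J ∪ K ∪ L) with hA
  have hT : ∀ i, i ∈ (J ∪ K ∪ L : Set I) → i ∈ A := fun i hi => ⟨i, hi, .refl⟩
  set B : Finset I := Finset.univ.filter fun i => i ∈ A ∧ i ∉ L ∧ D.Reach J L False i with hB
  set C : Finset I := Finset.univ.filter fun i => i ∈ A ∧ i ∉ L ∧ i ∉ B with hC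
  have hJB : J ⊆ B := fun i hi => by
    simp only [hB, Finset.mem_filter, Finset.mem_univ, true_and]
    exact ⟨hT i (.inl (.inl hi)), Finset.disjoint_left.1 hJL hi, .inl ⟨id, hi⟩⟩
  have hKC : K ⊆ C := fun i hi => by
    simp only [hC, Finset.mem_filter, Finset.mem_univ, true_and]
    refine ⟨hT i (.inl (.inr hi)), Finset.disjoint_left.1 hKL hi, fun hiB => ?_⟩
    simp only [hB, Finset.mem_filter, Finset.mem_univ, true_and] at hiB
    exact hn (hiB.2.2.mConnected hi hJK')
  have hBCL : ∀ i, i ∈ B ∪ C ∪ L ↔ i ∈ A := by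
    intro i
    have : i ∈ L → i ∈ A := fun h => hT i (.inr h)
    simp only [Finset.mem_union, hC, hB, Finset.mem_filter, Finset.mem_univ, true_and]
    tauto
  have hpa : ∀ i ∈ A, ∀ j ∈ insert i {j | D.dir j i}, j ∈ A := by
    rintro i ⟨t, ht, hit⟩ j (rfl | hj)
    · exact ⟨t, ht, hit⟩
    · exact ⟨t, ht, .head hj hit⟩
  -- The families in `A` are sorted according to whether they meet `B`.
  let M : Finset I := (B ∪ C ∪ L).filter fun i => ∃ v ∈ insert i {j | D.dir j i}, v ∈ B
  let N : Finset I := (B ∪ C ∪ L).filter fun i => ¬ ∃ v ∈ insert i {j | D.dir j i}, v ∈ B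
  refine condIndepGiven_of_mul μ hm h1 (B := B) (C := C)
    (f := fun x => ∏ i ∈ M, k i x) (g := fun x => ∏ i ∈ N, k i x) ?_ ?_ ?_ hJB hKC
    (Finset.measurable_prod _ fun i _ => hk.measurable i)
    (Finset.measurable_prod _ fun i _ => hk.measurable i) ?_ ?_ ?_
  · exact Finset.disjoint_left.2 fun i hi hi' => (Finset.mem_filter.1 hi').2.2.2 hi
  · exact Finset.disjoint_left.2 fun i hi hi' => (Finset.mem_filter.1 hi).2.2.1 hi'
  · exact Finset.disjoint_left.2 fun i hi hi' => (Finset.mem_filter.1 hi).2.2.1 hi'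
  · refine DependsOn.finset_prod fun i hi => (hk.dependsOn i).mono fun u hu => ?_
    obtain ⟨hiA, v, hv, hvB⟩ := Finset.mem_filter.1 hi
    rw [hBCL] at hiA
    by_cases huL : u ∈ L
    · exact .inr huL
    · obtain ⟨-, -, hvL, hvr⟩ := Finset.mem_filter.1 hvB
      exact .inl (Finset.mem_filter.2 ⟨Finset.mem_univ _, hpa i hiA u hu, huL,
        hvr.of_family hJK' hn hvL hiA hv hu huL⟩)
  · refine DependsOn.finset_prod fun i hi => (hk.dependsOn i).mono fun u hu => ?_
    obtain ⟨hiA, hv⟩ := Finset.mem_filter.1 hi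
    rw [hBCL] at hiA
    by_cases huL : u ∈ L
    · exact .inr huL
    · exact .inl (Finset.mem_filter.2 ⟨Finset.mem_univ _, hpa i hiA u hu, huL,
        fun huB => hv ⟨u, hu, huB⟩⟩)
  · rw [hk.lmarginal_prod μ hr]
    · ext x
      rw [compl_compl, Finset.prod_filter_mul_prod_filter_not]
    · intro i hi j hij
      rw [Finset.mem_compl, hBCL] at hi ⊢
      exact fun hj => hi (hpa j hj i (.inr hij))

end Factorization

/-! ### Conditional densities of Markov distributions -/

section Factorization

variable {I : Type*} [Fintype I] {Y : I → Type} [∀ i, MeasurableSpace (Y i)]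
  (μ : ∀ i, Measure (Y i))

open Classical in
/-- The conditional density of the coordinate `a` given the coordinates in `S`, for a joint density
`q`. Where the density of the coordinates in `S` is `0` or `∞`, the unconditional density of
coordinate `a` is used instead, so that the result is a probability density everywhere. -/
noncomputable def condDensity (q : (∀ i, Y i) → ℝ≥0∞) (a : I) (S : Finset I) (x : ∀ i, Y i) :
    ℝ≥0∞ :=
  if lmarginal μ Sᶜ q x ≠ 0 ∧ lmarginal μ Sᶜ q x ≠ ∞ then
    lmarginal μ (insert a S)ᶜ q x / lmarginal μ Sᶜ q x
  else lmarginal μ {a}ᶜ q x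

theorem dependsOn_condDensity (q : (∀ i, Y i) → ℝ≥0∞) (a : I) (S : Finset I) :
    DependsOn (condDensity μ q a S) (insert a (S : Set I)) := by
  classical
  have h : ∀ T : Finset I, (T : Set I) ⊆ insert a (S : Set I) →
      DependsOn (lmarginal μ Tᶜ q) (insert a (S : Set I)) := fun T hT =>
    (dependsOn_lmarginal μ Tᶜ q).mono (by simpa using hT)
  intro x y hxy
  unfold condDensity
  rw [h S (Set.subset_insert _ _) hxy, h (insert a S) (by simp) hxy, h {a} (by simp) hxy]

variable [∀ i, SigmaFinite (μ i)]

theorem measurable_condDensity {q : (∀ i, Y i) → ℝ≥0∞} (hq : Measurable q) (a : I)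
    (S : Finset I) : Measurable (condDensity μ q a S) := by
  classical
  unfold condDensity
  refine Measurable.ite ?_ ((hq.lmarginal μ).div (hq.lmarginal μ)) (hq.lmarginal μ)
  exact ((hq.lmarginal μ) (measurableSet_singleton 0)).compl.inter
    ((hq.lmarginal μ) (measurableSet_singleton ∞)).compl

open Classical in
theorem lintegral_condDensity {q : (∀ i, Y i) → ℝ≥0∞} (hq : Measurable q)
    (hq1 : ∫⁻ x, q x ∂Measure.pi μ = 1) {a : I} {S : Finset I} (ha : a ∉ S) (x : ∀ i, Y i) :
    ∫⁻ t, condDensity μ q a S (Function.update x a t) ∂μ a = 1 := by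
  have hS : ∀ t, lmarginal μ Sᶜ q (Function.update x a t) = lmarginal μ Sᶜ q x := fun t =>
    (dependsOn_lmarginal μ Sᶜ q).comp_update (by simpa using ha) x t
  have hint : ∀ T, a ∉ T → ∫⁻ t, lmarginal μ (insert a T)ᶜ q (Function.update x a t) ∂μ a =
      lmarginal μ Tᶜ q x := by
    intro T hT
    rw [← lmarginal_sdiff_lmarginal_compl μ (Finset.subset_insert a T) hq,
      Finset.insert_sdiff_cancel hT, lmarginal_singleton]
  unfold condDensity
  simp only [hS]
  split_ifs with h
  · have hm : Measurable fun t => lmarginal μ (insert a S)ᶜ q (Function.update x a t) :=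
      (hq.lmarginal μ).comp (measurable_update x)
    simp only [div_eq_mul_inv]
    rw [lintegral_mul_const _ hm, hint S ha, ENNReal.mul_inv_cancel h.1 h.2]
  · rw [← LawfulSingleton.insert_empty_eq, hint ∅ (Finset.notMem_empty a), Finset.compl_empty,
      ← lintegral_eq_lmarginal_univ, hq1]

open Classical in
/-- Every distribution with a density that satisfies the global Markov property of a directed
acyclic graph is the product of its conditional densities along the graph: the parents of a vertex
separate it from the vertices before it. -/
theorem MixedGraph.exists_isCondDensities {D : MixedGraph I} {r : I → ℕ}
    (hr : ∀ i j, D.dir i j → r i < r j) (hD : D.IsDirected) {Q : Measure (∀ i, Y i)}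
    (hQ : Q ∈ D.globalMarkovModel μ) :
    ∃ k, D.IsCondDensities μ k ∧ Q = (Measure.pi μ).withDensity fun x => ∏ i, k i x := by
  obtain ⟨⟨hprob, p, hp, hQp⟩, hM⟩ := hQ
  set q := Q.rnDeriv (Measure.pi μ) with hqdef
  have hq : Measurable q := Measure.measurable_rnDeriv _ _
  have hac : Q ≪ Measure.pi μ := hQp ▸ withDensity_absolutelyContinuous _ _
  have hQq : (Measure.pi μ).withDensity q = Q := Measure.withDensity_rnDeriv_eq _ _ hac
  have hq1 : ∫⁻ x, q x ∂Measure.pi μ = 1 := by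
    rw [← setLIntegral_univ, ← withDensity_apply _ .univ, hQq, measure_univ]
  let pa : I → Finset I := fun a => Finset.univ.filter fun i => D.dir i a
  have hpa : ∀ a i, i ∈ pa a ↔ D.dir i a := fun a i => by simp [pa]
  have hapa : ∀ a, a ∉ pa a := fun a h => (hr _ _ ((hpa a a).1 h)).false
  let k : I → (∀ i, Y i) → ℝ≥0∞ := fun a => condDensity μ q a (pa a)
  have hk : D.IsCondDensities μ k :=
    { measurable := fun a => measurable_condDensity μ hq a _
      dependsOn := fun a => (dependsOn_condDensity μ q a (pa a)).mono fun i hi => by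
        rcases hi with rfl | hi
        · exact .inl rfl
        · exact .inr ((hpa a i).1 hi)
      lintegral_eq_one := fun a x => lintegral_condDensity μ hq hq1 (hapa a) x }
  refine ⟨k, hk, ?_⟩
  have key : ∀ S : Finset I, (∀ i ∈ S, ∀ j, D.dir j i → j ∈ S) →
      lmarginal μ Sᶜ q =ᵐ[Measure.pi μ] fun x => ∏ i ∈ S, k i x := by
    intro S
    induction S using Finset.induction_on_max_value r with
    | empty =>
      intro _
      refine Filter.Eventually.of_forall fun x => ?_
      rw [Finset.compl_empty, ← lintegral_eq_lmarginal_univ, hq1]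
      exact Finset.prod_empty.symm
    | insert a s has hle ih =>
      intro hS
      have hs : ∀ i ∈ s, ∀ j, D.dir j i → j ∈ s := fun i hi j hji => by
        rcases Finset.mem_insert.1 (hS i (Finset.mem_insert_of_mem hi) j hji) with rfl | h
        · exact absurd (hr _ _ hji) (hle i hi).not_gt
        · exact h
      have hpas : pa a ⊆ s := fun j hj => by
        have hja := (hpa a j).1 hj
        rcases Finset.mem_insert.1 (hS a (Finset.mem_insert_self _ _) j hja) with rfl | h
        · exact absurd hj (hapa j)
        · exact h
      have hsep : ¬ D.MConnected ({a} : Finset I) (s \ pa a : Finset I) (pa a) := by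
        have hset : ((pa a : Finset I) : Set I) = {p | D.dir p a} := by ext; simp [pa]
        rw [Finset.coe_singleton, hset]
        refine not_mConnected_parents hr hD ?_ ?_ ?_
        · simp [has]
        · intro i hi
          exact hle i (Finset.mem_sdiff.1 hi).1
        · intro i hi h
          exact (Finset.mem_sdiff.1 hi).2 ((hpa a i).2 h)
      have hci := hM {a} (s \ pa a) (pa a) (by simp [has]) (by simpa using hapa a)
        Finset.sdiff_disjoint hsep
      have e1 : {a} ∪ s \ pa a ∪ pa a = insert a s := by
        rw [Finset.union_assoc, Finset.sdiff_union_of_subset hpas]; rfl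
      have e2 : s \ pa a ∪ pa a = s := Finset.sdiff_union_of_subset hpas
      have e3 : {a} ∪ pa a = insert a (pa a) := rfl
      unfold CondIndepGiven marginalDensity at hci
      rw [e1, e2, e3, ← hqdef] at hci
      filter_upwards [hci, ih hs, ae_lmarginal_lt_top μ (pa a)ᶜ hq (by simp [hq1]),
        ae_lmarginal_compl_eq_zero μ hpas hq,
        ae_lmarginal_compl_eq_zero μ (Finset.subset_insert a s) hq] with x h1 h2 h3 h4 h5
      rw [Finset.prod_insert has, ← h2]
      -- The Markov property says nothing where the density of the parents vanishes, but there the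
      -- joint densities vanish as well.
      by_cases h0 : lmarginal μ (pa a)ᶜ q x = 0
      · rw [h4 h0, h5 (h4 h0), mul_zero]
      · have hkx : k a x = lmarginal μ (insert a (pa a))ᶜ q x / lmarginal μ (pa a)ᶜ q x :=
          if_pos ⟨h0, h3.ne⟩
        have := h1 (pos_iff_ne_zero.2 h0)
        rw [← hkx, ← mul_div_assoc] at this
        rw [← ENNReal.div_mul_cancel (b := lmarginal μ (insert a s)ᶜ q x) h0 h3.ne, this,
          ENNReal.div_mul_cancel h0 h3.ne]
  have huniv := key Finset.univ (by simp)
  rw [Finset.compl_univ, lmarginal_empty] at huniv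
  rw [← hQq]
  exact withDensity_congr_ae huniv

end Factorization

/-! ### Elimination of latent variables -/

namespace MixedGraph

/-- There is a directed walk from `a` to `b` in `D` all of whose inner vertices lie in `S`. -/
inductive DirReach {I : Type*} (D : MixedGraph I) (S : Set I) : I → I → Prop
  | single {a b : I} : D.dir a b → DirReach D S a b
  | head {a c b : I} : D.dir a c → c ∈ S → DirReach D S c b → DirReach D S a b

theorem DirReach.tail {I : Type*} {D : MixedGraph I} {S : Set I} {a c b : I}
    (h : D.DirReach S a c) (hc : c ∈ S) (hb : D.dir c b) : D.DirReach S a b := by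
  induction h with
  | single h => exact .head h hc (.single hb)
  | head h hS _ ih => exact .head h hS (ih hc hb)

theorem DirReach.rank_lt {I : Type*} {D : MixedGraph I} {S : Set I} {r : I → ℕ}
    (hr : ∀ i j, D.dir i j → r i < r j) {a b : I} (h : D.DirReach S a b) : r a < r b := by
  induction h with
  | single h => exact hr _ _ h
  | head h _ _ ih => exact (hr _ _ h).trans ih

end MixedGraph

open Classical in
/-- A list of the elements of a finite set in reverse topological order: no element of the list
has an edge to a later one. -/
theorem Finset.exists_reverse_topological_list {I : Type*} (R : I → I → Prop) (r : I → ℕ)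
    (hr : ∀ i j, R i j → r i < r j) (S : Finset I) :
    ∃ l : List I, l.Nodup ∧ l.toFinset = S ∧ l.Pairwise fun a b => ¬ R a b := by
  induction S using Finset.induction_on_max_value r with
  | empty => exact ⟨[], by simp⟩
  | insert a s has hle ih =>
    obtain ⟨l, hl, rfl, hp⟩ := ih
    refine ⟨a :: l, List.nodup_cons.2 ⟨by simpa using has, hl⟩, by simp,
      List.pairwise_cons.2 ⟨fun b hb hab => ?_, hp⟩⟩
    exact absurd (hr _ _ hab) (hle b (List.mem_toFinset.2 hb)).not_gt

section Structural

variable {I : Type*} {Y : I → Type}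

open Classical in
/-- Solve the structural equations `x a = F a x (u a)` one after the other, for the vertices `a` of
a list, the last one first. The remaining coordinates of `x` are kept. -/
noncomputable def solve (F : ∀ a, (∀ i, Y i) → unitInterval → Y a) :
    List I → (∀ i, Y i) → (I → unitInterval) → ∀ i, Y i
  | [], x, _ => x
  | a :: l, x, u => Function.update (solve F l x u) a (F a (solve F l x u) (u a))

variable {F : ∀ a, (∀ i, Y i) → unitInterval → Y a}

theorem solve_of_notMem {l : List I} {i : I} (hi : i ∉ l) (x : ∀ i, Y i) (u : I → unitInterval) :
    solve F l x u i = x i := by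
  classical
  induction l with
  | nil => rfl
  | cons a l ih =>
    simp only [List.mem_cons, not_or] at hi
    rw [solve, Function.update_of_ne hi.1, ih hi.2]

open Classical in
theorem solve_update_of_notMem {l : List I} {a : I} (ha : a ∉ l) (x : ∀ i, Y i)
    (u : I → unitInterval) (t : unitInterval) :
    solve F l x (Function.update u a t) = solve F l x u := by
  induction l with
  | nil => rfl
  | cons b l ih =>
    simp only [List.mem_cons, not_or] at ha
    rw [solve, ih ha.2, solve, Function.update_of_ne (Ne.symm ha.1)]

/-- A solved coordinate depends only on itself, and on the coordinates and the noise of vertices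
that reach it by a directed walk through solved vertices. -/
theorem solve_congr {D : MixedGraph I} {S : Set I}
    (hF : ∀ a ∈ S, ∀ u, DependsOn (fun x => F a x u) {j | D.dir j a}) {l : List I}
    (hl : ∀ a ∈ l, a ∈ S) {x x' : ∀ i, Y i} {u u' : I → unitInterval} {i : I}
    (h : ∀ j, (j = i ∨ (i ∈ S ∧ D.DirReach S j i)) →
      x j = x' j ∧ (j ∈ S → u j = u' j)) :
    solve F l x u i = solve F l x' u' i := by
  classical
  induction l generalizing i with
  | nil => exact (h i (.inl rfl)).1
  | cons a l ih =>
    have ih := @ih fun b hb => hl b (List.mem_cons_of_mem _ hb)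
    by_cases hi : i = a
    · subst hi
      have hiS := hl i List.mem_cons_self
      rw [solve, solve, Function.update_self, Function.update_self, (h i (.inl rfl)).2 hiS]
      refine hF i hiS _ fun p hp => ih fun j hj => h j (.inr ⟨hiS, ?_⟩)
      rcases hj with rfl | ⟨hpS, hjp⟩
      · exact .single hp
      · exact hjp.tail hpS hp
    · rw [solve, solve, Function.update_of_ne hi, Function.update_of_ne hi]
      exact ih h

variable [∀ i, MeasurableSpace (Y i)]

theorem measurable_solve (hF : ∀ a, Measurable fun p : (∀ i, Y i) × unitInterval => F a p.1 p.2)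
    (l : List I) :
    Measurable fun p : (∀ i, Y i) × (I → unitInterval) => solve F l p.1 p.2 := by
  classical
  induction l with
  | nil => exact measurable_fst
  | cons a l ih =>
    refine measurable_pi_lambda _ fun i => ?_
    by_cases hi : i = a
    · subst hi
      simp only [solve, Function.update_self]
      exact (hF i).comp (ih.prodMk ((measurable_pi_apply i).comp measurable_snd))
    · simp only [solve, Function.update_of_ne hi]
      exact (measurable_pi_apply i).comp ih

variable (μ : ∀ i, Measure (Y i)) [∀ i, SigmaFinite (μ i)]

open Classical in
/-- A conditional density on a standard Borel space is the law of a structural equation with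
uniform noise. -/
theorem exists_structural_equation {k : (∀ i, Y i) → ℝ≥0∞} (hk : Measurable k) {a : I} {P : Set I}
    (haP : a ∉ P) (hkd : DependsOn k (insert a P))
    (hk1 : ∀ x, ∫⁻ t, k (Function.update x a t) ∂μ a = 1) (x₀ : ∀ i, Y i)
    [StandardBorelSpace (Y a)] :
    ∃ F : (∀ i, Y i) → unitInterval → Y a,
      Measurable (fun p : (∀ i, Y i) × unitInterval => F p.1 p.2) ∧
      (∀ u, DependsOn (fun x => F x u) P) ∧
      ∀ (x : ∀ i, Y i) (g : Y a → ℝ≥0∞), Measurable g →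
        ∫⁻ t, g (F x t) = ∫⁻ y, g y * k (Function.update x a y) ∂μ a := by
  have hupd : Measurable fun p : (∀ i, Y i) × Y a => Function.update p.1 a p.2 :=
    measurable_update'
  have hku : Measurable (Function.uncurry fun (x : ∀ i, Y i) (y : Y a) =>
      k (Function.update x a y)) := hk.comp hupd
  let κ : ProbabilityTheory.Kernel (∀ i, Y i) (Y a) :=
    (ProbabilityTheory.Kernel.const _ (μ a)).withDensity fun x y => k (Function.update x a y)
  have hκ : ∀ x, κ x = (μ a).withDensity fun y => k (Function.update x a y) := fun x => by
    simp only [κ]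
    rw [ProbabilityTheory.Kernel.withDensity_apply _ hku, ProbabilityTheory.Kernel.const_apply]
  have : ProbabilityTheory.IsMarkovKernel κ := ⟨fun x => ⟨by
    rw [hκ, withDensity_apply _ .univ, setLIntegral_univ, hk1]⟩⟩
  have : Nonempty (Y a) := ⟨x₀ a⟩
  obtain ⟨f, hf, hfκ⟩ := κ.exists_measurable_map_eq_unitInterval
  -- Freezing the coordinates outside `P` makes the equation depend on the coordinates in `P` only.
  let π : (∀ i, Y i) → ∀ i, Y i := fun x i => if i ∈ P then x i else x₀ i
  have hπ : Measurable π := measurable_pi_lambda _ fun i => by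
    by_cases hi : i ∈ P
    · simpa [π, hi] using measurable_pi_apply i
    · simp [π, hi]
  refine ⟨fun x u => f (π x) u, hf.comp ((hπ.comp measurable_fst).prodMk measurable_snd),
    fun u x x' h => ?_, fun x g hg => ?_⟩
  · have : π x = π x' := by
      ext i
      by_cases hi : i ∈ P
      · simp [π, hi, h i hi]
      · simp [π, hi]
    simp only [this]
  · have hfm : Measurable (f (π x)) := hf.comp (measurable_const.prodMk measurable_id)
    have hkm : Measurable fun y => k (Function.update (π x) a y) := hk.comp (measurable_update _)
    have hkπ : ∀ y, k (Function.update (π x) a y) = k (Function.update x a y) := fun y =>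
      hkd fun i hi => by
        by_cases hia : i = a
        · subst hia; simp
        · rcases hi with hi | hi
          · exact (hia hi).elim
          · simp [hia, π, hi]
    rw [← lintegral_map hg hfm, hfκ, hκ, lintegral_withDensity_eq_lintegral_mul _ hkm hg]
    refine lintegral_congr fun y => ?_
    rw [Pi.mul_apply, hkπ, mul_comm]

variable [Fintype I]

open Classical in
/-- If the noise is independent and uniform, then the solutions of structural equations that
represent the conditional densities `k a` have the product of these as their density. -/
theorem lintegral_solve {k : I → (∀ i, Y i) → ℝ≥0∞} (hk : ∀ i, Measurable (k i))
    (hF : ∀ a, Measurable fun p : (∀ i, Y i) × unitInterval => F a p.1 p.2) {l : List I}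
    (hFk : ∀ a ∈ l, ∀ (x : ∀ i, Y i) (g : Y a → ℝ≥0∞), Measurable g →
      ∫⁻ t, g (F a x t) = ∫⁻ y, g y * k a (Function.update x a y) ∂μ a)
    (hl : l.Nodup) (hlk : l.Pairwise fun a b => DependsOn (k b) {a}ᶜ)
    {f : (∀ i, Y i) → ℝ≥0∞} (hf : Measurable f) (x : ∀ i, Y i) :
    ∫⁻ u, f (solve F l x u) ∂Measure.pi (fun _ : I => (volume : Measure unitInterval)) =
      lmarginal μ l.toFinset (fun y => f y * ∏ i ∈ l.toFinset, k i y) x := by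
  induction l generalizing f with
  | nil => simp [solve]
  | cons a l ih =>
    obtain ⟨hal, hl⟩ := List.nodup_cons.1 hl
    obtain ⟨hak, hlk⟩ := List.pairwise_cons.1 hlk
    have ih := @ih (fun b hb => hFk b (List.mem_cons_of_mem _ hb)) hl hlk
    have hz : Measurable fun u => solve F l x u :=
      (measurable_solve hF l).comp (measurable_const.prodMk measurable_id)
    have hupd : Measurable fun p : (∀ i, Y i) × Y a => Function.update p.1 a p.2 :=
      measurable_update'
    have hH : Measurable fun p : (I → unitInterval) × unitInterval =>
        f (Function.update (solve F l x p.1) a (F a (solve F l x p.1) p.2)) :=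
      hf.comp (hupd.comp ((hz.comp measurable_fst).prodMk
        ((hF a).comp ((hz.comp measurable_fst).prodMk measurable_snd))))
    -- The noise of `a` does not enter the equations solved before, so it can be integrated alone.
    have h1 : ∫⁻ u, f (solve F (a :: l) x u)
          ∂Measure.pi (fun _ : I => (volume : Measure unitInterval)) =
        ∫⁻ u, (∫⁻ t, f (Function.update (solve F l x u) a (F a (solve F l x u) t)))
          ∂Measure.pi (fun _ : I => (volume : Measure unitInterval)) := by
      refine lintegral_eq_of_lmarginal_eq {a} ?_ hH.lintegral_prod_right' ?_
      · exact hH.comp (measurable_id.prodMk (measurable_pi_apply a))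
      · rw [lmarginal_singleton, lmarginal_singleton]
        ext u
        simp only [solve, solve_update_of_notMem hal, Function.update_self]
        simp
    have hfk : Measurable fun y => f y * k a y := hf.mul (hk a)
    have h2 : ∀ z : ∀ i, Y i, ∫⁻ t, f (Function.update z a (F a z t)) =
        lmarginal μ {a} (fun y => f y * k a y) z := by
      intro z
      rw [lmarginal_singleton]
      exact hFk a List.mem_cons_self z (fun y => f (Function.update z a y))
        (hf.comp (measurable_update z))
    rw [h1]
    simp only [h2]
    have hprod : DependsOn (fun y => ∏ i ∈ l.toFinset, k i y) {a}ᶜ :=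
      DependsOn.finset_prod fun i hi => hak i (List.mem_toFinset.1 hi)
    have hpm : Measurable fun y => ∏ i ∈ l.toFinset, k i y :=
      Finset.measurable_prod _ fun i _ => hk i
    have hal' : a ∉ l.toFinset := by simpa using hal
    rw [ih (hfk.lmarginal μ), ← lmarginal_mul_right μ hprod (by simp) hfk,
      ← lmarginal_union μ (fun y => f y * k a y * ∏ i ∈ l.toFinset, k i y) (hfk.mul hpm)
        (Finset.disjoint_singleton_right.2 hal'),
      List.toFinset_cons, Finset.insert_eq, Finset.union_comm]
    simp only [← Finset.insert_eq, Finset.prod_insert hal', mul_assoc]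

/-- The coordinates in `S` of a distribution that factorizes along `D` can be generated from the
other coordinates and from independent uniform noise, one noise variable for each vertex in `S`. -/
theorem MixedGraph.IsCondDensities.exists_solution [inst : DecidableEq I] {D : MixedGraph I} {r : I → ℕ}
    (hr : ∀ i j, D.dir i j → r i < r j) {k : I → (∀ i, Y i) → ℝ≥0∞}
    (hk : D.IsCondDensities μ k) (S : Finset I) (hS : ∀ i ∈ S, StandardBorelSpace (Y i))
    (x₀ : ∀ i, Y i) :
    ∃ Z : (∀ i, Y i) → (I → unitInterval) → ∀ i, Y i,
      Measurable (fun p : (∀ i, Y i) × (I → unitInterval) => Z p.1 p.2) ∧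
      (∀ x u, ∀ i ∉ S, Z x u i = x i) ∧
      (∀ x x' u u' i, (∀ j, (j = i ∨ (i ∈ S ∧ D.DirReach S j i)) →
        x j = x' j ∧ (j ∈ S → u j = u' j)) → Z x u i = Z x' u' i) ∧
      ∀ f : (∀ i, Y i) → ℝ≥0∞, Measurable f → ∀ x,
        ∫⁻ u, f (Z x u) ∂Measure.pi (fun _ : I => (volume : Measure unitInterval)) =
          lmarginal μ S (fun y => f y * ∏ i ∈ S, k i y) x := by
  obtain rfl : inst = fun a b => Classical.propDecidable (a = b) := Subsingleton.elim _ _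
  classical
  have hex : ∀ a, ∃ F : (∀ i, Y i) → unitInterval → Y a,
      Measurable (fun p : (∀ i, Y i) × unitInterval => F p.1 p.2) ∧
      (a ∈ S → (∀ u, DependsOn (fun x => F x u) {j | D.dir j a}) ∧
        ∀ (x : ∀ i, Y i) (g : Y a → ℝ≥0∞), Measurable g →
        ∫⁻ t, g (F x t) = ∫⁻ y, g y * k a (Function.update x a y) ∂μ a) := by
    intro a
    by_cases ha : a ∈ S
    · have := hS a ha
      obtain ⟨F, h1, h2, h3⟩ := exists_structural_equation μ (P := {j | D.dir j a}) (hk.measurable a)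
        (fun h => (hr a a h).false) (hk.dependsOn a) (hk.lintegral_eq_one a) x₀
      exact ⟨F, h1, fun _ => ⟨h2, h3⟩⟩
    · exact ⟨fun x _ => x a, (measurable_pi_apply a).comp measurable_fst, fun h => (ha h).elim⟩
  choose F hFm hF using hex
  obtain ⟨l, hl, hlS, hlp⟩ := Finset.exists_reverse_topological_list D.dir r hr S
  have hlS' : ∀ a, a ∈ l ↔ a ∈ S := fun a => by rw [← hlS, List.mem_toFinset]
  refine ⟨solve F l, measurable_solve hFm l, fun x u i hi => solve_of_notMem
    (fun h => hi ((hlS' i).1 h)) x u, fun x x' u u' i h => solve_congr (S := S)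
    (fun a ha => (hF a ha).1) (fun a ha => (hlS' a).1 ha) h, fun f hf x => ?_⟩
  rw [lintegral_solve μ hk.measurable hFm (fun a ha => (hF a ((hlS' a).1 ha)).2) hl ?_ hf, hlS]
  refine (List.pairwise_and_iff.2 ⟨hlp, hl⟩).imp fun {a b} h => (hk.dependsOn b).mono ?_
  rintro j (rfl | hj)
  · exact Ne.symm h.2
  · rintro rfl
    exact h.1 hj

/-- A distribution of variables with conditional densities `k` has the same integrals as the
distribution in which the coordinates in `S` are generated from noise by `Z`. -/
theorem lintegral_mul_prod_eq_lintegral_lintegral [DecidableEq I] {k : I → (∀ i, Y i) → ℝ≥0∞}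
    (hk : ∀ i, Measurable (k i)) {S : Finset I} (hS : ∀ i ∈ S, IsProbabilityMeasure (μ i))
    {Z : (∀ i, Y i) → (I → unitInterval) → ∀ i, Y i} {f : (∀ i, Y i) → ℝ≥0∞} (hf : Measurable f)
    (hZ : ∀ x, ∫⁻ u, f (Z x u) ∂Measure.pi (fun _ : I => (volume : Measure unitInterval)) =
      lmarginal μ S (fun y => f y * ∏ i ∈ S, k i y) x) :
    ∫⁻ x, f x * ∏ i ∈ S, k i x ∂Measure.pi μ = ∫⁻ x, (∫⁻ u, f (Z x u)
      ∂Measure.pi (fun _ : I => (volume : Measure unitInterval))) ∂Measure.pi μ := by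
  have hm : Measurable fun y => f y * ∏ i ∈ S, k i y :=
    hf.mul (Finset.measurable_prod _ fun i _ => hk i)
  simp only [hZ]
  refine lintegral_eq_of_lmarginal_eq S hm (hm.lmarginal μ) ?_
  rw [lmarginal_eq_self μ hS (dependsOn_lmarginal μ S _) disjoint_compl_left]

end Structural

/-- Independent uniform variables indexed by `I` can be generated from independent uniform
variables indexed by `C`, the variable `a` from the variable `c a` alone. -/
theorem exists_measurePreserving_regroup {I C : Type*} [Fintype I] [Fintype C] (c : I → C) :
    ∃ g : I → unitInterval → unitInterval, (∀ a, Measurable (g a)) ∧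
      MeasurePreserving (fun (e : C → unitInterval) (a : I) => g a (e (c a)))
        (Measure.pi fun _ => volume) (Measure.pi fun _ => volume) := by
  classical
  obtain ⟨γ, hγ, hγm⟩ := MeasureTheory.Measure.exists_measurable_map_eq
    (Measure.pi fun _ : I => (volume : Measure unitInterval))
  -- The map `γ` turns a single uniform variable into a whole family of independent ones. It is
  -- applied to every `e C`, and `a` reads off its coordinate of `γ (e (c a))`. The index `a` is
  -- never used for two different `C`, so the coordinates that are read off are independent.
  have hγa : ∀ a, Measurable fun t => γ t a := fun a => (measurable_pi_apply a).comp hγ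
  have hgm : Measurable fun (e : C → unitInterval) (a : I) => γ (e (c a)) a :=
    measurable_pi_lambda _ fun a => (hγa a).comp (measurable_pi_apply _)
  refine ⟨fun a t => γ t a, hγa, hgm, ?_⟩
  refine (Measure.pi_eq fun s hs => ?_).symm
  let s' : C → I → Set unitInterval := fun C a => if c a = C then s a else Set.univ
  have hs' : ∀ C a, MeasurableSet (s' C a) := fun C a => by
    by_cases h : c a = C
    · simpa [s', h] using hs a
    · simp [s', h]
  have hpre : (fun (e : C → unitInterval) (a : I) => γ (e (c a)) a) ⁻¹' Set.univ.pi s =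
      Set.univ.pi fun C => γ ⁻¹' Set.univ.pi (s' C) := by
    ext e
    simp only [Set.mem_preimage, Set.mem_pi, Set.mem_univ, true_imp_iff]
    refine ⟨fun h C a => ?_, fun h a => by simpa [s'] using h (c a) a⟩
    by_cases hC : c a = C
    · simpa [s', hC] using hC ▸ h a
    · simp [s', hC]
  rw [Measure.map_apply hgm (.univ_pi hs), hpre, Measure.pi_pi]
  simp only [← Measure.map_apply hγ (MeasurableSet.univ_pi (hs' _)), hγm, Measure.pi_pi]
  rw [Finset.prod_comm]
  refine Finset.prod_congr rfl fun a _ => ?_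
  rw [Finset.prod_eq_single (c a)]
  · simp [s']
  · intro C _ hC
    simp [s', hC.symm]
  · simp

/-! ### The clique expansion model -/

section Expand

variable {V : Type*} {X : V → Type} [∀ v, MeasurableSpace (X v)]

instance sigmaFinite_expandMeasure (μ : ∀ v, Measure (X v)) [hμ : ∀ v, SigmaFinite (μ v)]
    (W : Type*) : ∀ i, SigmaFinite (expandMeasure μ W i)
  | .inl v => hμ v
  | .inr _ => inferInstanceAs (SigmaFinite (volume : Measure unitInterval))

instance isProbabilityMeasure_expandMeasure_inr (μ : ∀ v, Measure (X v)) {W : Type*} (w : W) :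
    IsProbabilityMeasure (expandMeasure μ W (.inr w)) :=
  inferInstanceAs (IsProbabilityMeasure (volume : Measure unitInterval))

instance standardBorelSpace_expandSpace_inr {W : Type*} (w : W) :
    StandardBorelSpace (ExpandSpace X W (.inr w)) :=
  inferInstanceAs (StandardBorelSpace unitInterval)

theorem measurable_comp_inl (W : Type*) :
    Measurable fun (x : ∀ i, ExpandSpace X W i) (v : V) => x (.inl v) :=
  measurable_pi_lambda _ fun v => measurable_pi_apply (Sum.inl v)

variable [Fintype V] (μ : ∀ v, Measure (X v)) [∀ v, SigmaFinite (μ v)]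

theorem measurePreserving_comp_inl (W : Type*) [Fintype W] :
    MeasurePreserving (fun (x : ∀ i, ExpandSpace X W i) (v : V) => x (.inl v))
      (Measure.pi (expandMeasure μ W)) (Measure.pi μ) := by
  have h := measurePreserving_sumPiEquivProdPi (expandMeasure μ W)
  have : IsProbabilityMeasure (Measure.pi fun w : W => expandMeasure μ W (.inr w)) :=
    inferInstance
  exact (measurePreserving_fst (μ := Measure.pi fun v : V => expandMeasure μ W (.inl v))
    (ν := Measure.pi fun w : W => expandMeasure μ W (.inr w))).comp h

/-- Integration over the expanded space, first over the observed and then over the latent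
variables. -/
theorem lintegral_expand (W : Type*) [Fintype W] {f : (∀ v, X v) → (W → unitInterval) → ℝ≥0∞}
    (hf : Measurable fun p : (∀ v, X v) × (W → unitInterval) => f p.1 p.2) :
    ∫⁻ x, f (fun v => x (.inl v)) (fun w => x (.inr w)) ∂Measure.pi (expandMeasure μ W) =
      ∫⁻ z, (∫⁻ e, f z e ∂Measure.pi fun _ => volume) ∂Measure.pi μ := by
  have h := measurePreserving_sumPiEquivProdPi (expandMeasure μ W)
  have h2 := h.lintegral_comp hf
  have h3 : ∫⁻ p : (∀ v, X v) × (W → unitInterval), f p.1 p.2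
      ∂((Measure.pi μ).prod (Measure.pi fun _ => volume)) =
      ∫⁻ z, (∫⁻ e, f z e ∂Measure.pi fun _ => volume) ∂Measure.pi μ :=
    lintegral_prod _ hf.aemeasurable
  exact h2.trans h3

end Expand

namespace MixedGraph

variable {V : Type*} {G : MixedGraph V}

theorem cliqueExpansion_isDirected : G.cliqueExpansion.IsDirected := fun _ _ h => h

theorem exists_rank_cliqueExpansion {r : V → ℕ} (hr : ∀ i j, G.dir i j → r i < r j) :
    ∃ r' : V ⊕ G.Clique → ℕ, ∀ i j, G.cliqueExpansion.dir i j → r' i < r' j := by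
  refine ⟨Sum.elim (fun v => r v + 1) fun _ => 0, ?_⟩
  rintro (i | C) (j | C') h
  · exact Nat.add_lt_add_right (hr i j h) 1
  · exact h.elim
  · exact Nat.succ_pos _
  · exact h.elim

variable [Fintype V] {X : V → Type} [∀ v, MeasurableSpace (X v)]
  (μ : ∀ v, Measure (X v)) [∀ v, SigmaFinite (μ v)]

open Classical in
/-- A sufficient condition for membership in the clique expansion model: the observed variables
have conditional densities given their parents and one uniform variable for every clique that
contains them. -/
theorem mem_CEModel_of_factors {r : V → ℕ} (hr : ∀ i j, G.dir i j → r i < r j)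
    [Nonempty (∀ v, X v)] {φ : V → (∀ i, ExpandSpace X G.Clique i) → ℝ≥0∞}
    (hφ : ∀ v, Measurable (φ v))
    (hφd : ∀ v, DependsOn (φ v) (insert (.inl v) {j | G.cliqueExpansion.dir j (.inl v)}))
    (hφ1 : ∀ v y, ∫⁻ t, φ v (Function.update y (.inl v) t) ∂μ v = 1)
    {P : Measure (∀ v, X v)}
    (hP : ∀ f : (∀ v, X v) → ℝ≥0∞, Measurable f → ∫⁻ x, f x ∂P =
      ∫⁻ y, f (fun v => y (.inl v)) * ∏ v, φ v y ∂Measure.pi (expandMeasure μ G.Clique)) :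
    P ∈ G.CEModel μ := by
  obtain ⟨r', hr'⟩ := exists_rank_cliqueExpansion hr
  have hne : Nonempty (∀ i, ExpandSpace X G.Clique i) :=
    ‹Nonempty (∀ v, X v)›.map fun x i => match i with
      | .inl v => x v
      | .inr _ => (0 : unitInterval)
  -- The latent variables are independent and uniform.
  let k : V ⊕ G.Clique → (∀ i, ExpandSpace X G.Clique i) → ℝ≥0∞ := Sum.elim φ fun _ _ => 1
  have hk : G.cliqueExpansion.IsCondDensities (expandMeasure μ G.Clique) k :=
    { measurable := by
        rintro (v | C)
        · exact hφ v
        · exact measurable_const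
      dependsOn := by
        rintro (v | C)
        · exact hφd v
        · exact fun _ _ _ => rfl
      lintegral_eq_one := by
        rintro (v | C) x
        · refine (lintegral_congr fun t => ?_).trans (hφ1 v x)
          congr!
        · simp [k] }
  refine ⟨_, hk.mem_globalMarkovModel (expandMeasure μ G.Clique) hr', ?_⟩
  have hprod : ∀ x, ∏ i, k i x = ∏ v, φ v x := fun x => by simp [k, Fintype.prod_sum_type]
  simp only [hprod]
  have hm : Measurable fun x => ∏ v, φ v x := Finset.measurable_prod _ fun v _ => hφ v
  refine Measure.ext fun s hs => ?_
  rw [← lintegral_indicator_one hs, ← lintegral_indicator_one hs, hP _ (measurable_one.indicator hs),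
    margDist, lintegral_map (measurable_one.indicator hs) (measurable_comp_inl _),
    lintegral_withDensity_eq_lintegral_mul _ hm
      (g := fun y => s.indicator (1 : (∀ v, X v) → ℝ≥0∞) fun v => y (.inl v))
      ((measurable_one.indicator hs).comp (measurable_comp_inl _))]
  exact lintegral_congr fun y => mul_comm _ _

/-- Directed graphs are contained in their clique expansion; their model does not need the
latent variables. -/
theorem globalMarkovModel_subset_CEModel {r : V → ℕ} (hr : ∀ i j, G.dir i j → r i < r j)
    (hG : G.IsDirected) : G.globalMarkovModel μ ⊆ G.CEModel μ := by
  classical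
  intro P hP
  obtain ⟨k, hk, rfl⟩ := exists_isCondDensities μ hr hG hP
  have hprob : IsProbabilityMeasure ((Measure.pi μ).withDensity fun x => ∏ i, k i x) := hP.1.1
  have hne := nonempty_of_isProbabilityMeasure ((Measure.pi μ).withDensity fun x => ∏ i, k i x)
  have hm : Measurable fun x => ∏ v, k v x := Finset.measurable_prod _ fun v _ => hk.measurable v
  refine mem_CEModel_of_factors μ hr (φ := fun v y => k v fun j => y (.inl j))
    (fun v => (hk.measurable v).comp (measurable_comp_inl _)) (fun v y y' h => ?_)
    (fun v y => ?_) fun f hf => ?_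
  · refine hk.dependsOn v fun j hj => h _ ?_
    rcases hj with rfl | hj
    · exact .inl rfl
    · exact .inr hj
  · rw [← hk.lintegral_update v fun j => y (.inl j)]
    refine lintegral_congr fun t => congrArg (k v) ?_
    ext j
    by_cases hj : j = v
    · subst hj; simp
    · simp [hj]
  · rw [lintegral_withDensity_eq_lintegral_mul _ hm hf,
      ← (measurePreserving_comp_inl μ G.Clique).lintegral_comp (hm.mul hf)]
    exact lintegral_congr fun y => mul_comm _ _

open Classical in
/-- If the latent variables of a directed graph `D` over `G` can be assigned to cliques of `G` in
such a way that every latent variable only influences the observed variables in its clique, then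
the observed margins of the model of `D` belong to the clique expansion model of `G`. -/
theorem margDist_margDist_mem_CEModel {W W' : Type*} [Fintype W] [Fintype W']
    {r : V → ℕ} (hr : ∀ i j, G.dir i j → r i < r j)
    {D : MixedGraph ((V ⊕ W) ⊕ W')} {rD : (V ⊕ W) ⊕ W' → ℕ}
    (hrD : ∀ i j, D.dir i j → rD i < rD j) (hD : D.IsDirected)
    {S : Finset ((V ⊕ W) ⊕ W')} (hS : ∀ i, i ∈ S ↔ ∀ v, i ≠ .inl (.inl v))
    (hdir : ∀ j v, D.DirReach S (.inl (.inl j)) (.inl (.inl v)) → G.dir j v)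
    (c : (V ⊕ W) ⊕ W' → G.Clique)
    (hc : ∀ a ∈ S, ∀ v, D.DirReach S a (.inl (.inl v)) → v ∈ (c a).1)
    {Q : Measure (∀ i, ExpandSpace (ExpandSpace X W) W' i)}
    (hQ : Q ∈ D.globalMarkovModel (expandMeasure (expandMeasure μ W) W')) :
    margDist (margDist Q) ∈ G.CEModel μ := by
  set ν := expandMeasure (expandMeasure μ W) W'
  obtain ⟨k, hk, rfl⟩ := exists_isCondDensities ν hrD hD hQ
  have hprob : IsProbabilityMeasure ((Measure.pi ν).withDensity fun x => ∏ i, k i x) := hQ.1.1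
  obtain ⟨x₀⟩ := nonempty_of_isProbabilityMeasure
    ((Measure.pi ν).withDensity fun x => ∏ i, k i x)
  have : Nonempty (∀ v, X v) := ⟨fun v => x₀ (.inl (.inl v))⟩
  have hSB : ∀ i ∈ S, StandardBorelSpace (ExpandSpace (ExpandSpace X W) W' i) := by
    rintro ((v | w) | w') hi
    · exact ((hS _).1 hi v rfl).elim
    · exact standardBorelSpace_expandSpace_inr (X := X) w
    · infer_instance
  have hSP : ∀ i ∈ S, IsProbabilityMeasure (ν i) := by
    rintro ((v | w) | w') hi
    · exact ((hS _).1 hi v rfl).elim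
    · exact isProbabilityMeasure_expandMeasure_inr μ w
    · exact isProbabilityMeasure_expandMeasure_inr (expandMeasure μ W) w'
  obtain ⟨Z, hZm, hZv, hZc, hZi⟩ := hk.exists_solution ν hrD S hSB x₀
  obtain ⟨g, -, hgm⟩ := exists_measurePreserving_regroup c
  have hvS : ∀ v : V, (.inl (.inl v) : (V ⊕ W) ⊕ W') ∉ S := fun v h => (hS _).1 h v rfl
  -- The latent coordinates of a point of the observed space are filled in arbitrarily.
  let ext : (∀ v, X v) → ∀ i, ExpandSpace (ExpandSpace X W) W' i := fun x i => match i with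
    | .inl (.inl v) => x v
    | .inl (.inr w) => x₀ (.inl (.inr w))
    | .inr w' => x₀ (.inr w')
  have hext : Measurable ext := by
    refine measurable_pi_lambda _ ?_
    rintro ((v | w) | w')
    · exact measurable_pi_apply v
    · exact measurable_const
    · exact measurable_const
  let res : (∀ i, ExpandSpace (ExpandSpace X W) W' i) → ∀ v, X v := fun x v => x (.inl (.inl v))
  have hres : MeasurePreserving res (Measure.pi ν) (Measure.pi μ) :=
    (measurePreserving_comp_inl μ W).comp (measurePreserving_comp_inl (expandMeasure μ W) W')
  let reg : (G.Clique → unitInterval) → (V ⊕ W) ⊕ W' → unitInterval := fun e a => g a (e (c a))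
  let ψ : (∀ v, X v) → (G.Clique → unitInterval) → ∀ i, ExpandSpace (ExpandSpace X W) W' i :=
    fun z e => Z (ext z) (reg e)
  have hψ : Measurable fun p : (∀ v, X v) × (G.Clique → unitInterval) => ψ p.1 p.2 :=
    hZm.comp ((hext.comp measurable_fst).prodMk (hgm.measurable.comp measurable_snd))
  have hsplit : Measurable fun y : ∀ i, ExpandSpace X G.Clique i =>
      ((fun v => y (.inl v), fun C => y (.inr C)) : (∀ v, X v) × (G.Clique → unitInterval)) :=
    (measurable_comp_inl _).prodMk (measurable_pi_lambda _ fun C => measurable_pi_apply (Sum.inr C))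
  have hreach : ∀ {j p} {v : V}, D.dir p (.inl (.inl v)) →
      (j = p ∨ (p ∈ S ∧ D.DirReach S j p)) → D.DirReach S j (.inl (.inl v)) := by
    rintro j p v hp (rfl | ⟨hpS, hjp⟩)
    · exact .single hp
    · exact hjp.tail hpS hp
  refine mem_CEModel_of_factors μ hr
    (φ := fun v y => k (.inl (.inl v)) (ψ (fun v => y (.inl v)) fun C => y (.inr C)))
    (fun v => (hk.measurable _).comp (hψ.comp hsplit)) (fun v y y' h => ?_) (fun v y => ?_)
    fun f hf => ?_
  · refine hk.dependsOn _ fun p hp => ?_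
    rcases hp with rfl | hp
    · simp only [ψ]
      rw [hZv _ _ _ (hvS v), hZv _ _ _ (hvS v)]
      exact h _ (.inl rfl)
    · refine hZc _ _ _ _ _ fun j hj => ?_
      have hjv := hreach hp hj
      refine ⟨?_, fun hjS => congrArg (g j) (h _ (.inr (hc j hjS v hjv)))⟩
      rcases j with (j | w) | w'
      · exact h (.inl j) (.inr (hdir j v hjv))
      · rfl
      · rfl
  · rw [← hk.lintegral_update (.inl (.inl v)) (ψ (fun v => y (.inl v)) fun C => y (.inr C))]
    refine lintegral_congr fun t => hk.dependsOn _ fun p hp => ?_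
    rcases hp with rfl | hp
    · simp only [ψ]
      rw [hZv _ _ _ (hvS v), Function.update_self]
      exact Function.update_self _ _ _
    · have hpv : p ≠ .inl (.inl v) := fun h => (hrD _ _ (h ▸ hp)).false
      rw [Function.update_of_ne hpv]
      refine hZc _ _ _ _ _ fun j hj => ?_
      have hjv := (hreach hp hj).rank_lt hrD
      refine ⟨?_, fun hjS => rfl⟩
      rcases j with (j | w) | w'
      · have hne : (Sum.inl j : V ⊕ G.Clique) ≠ .inl v := by
          intro h
          cases h
          exact hjv.false
        exact Function.update_of_ne hne t y
      · rfl
      · rfl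
  · have hm : Measurable fun x => ∏ i, k i x :=
      Finset.measurable_prod _ fun i _ => hk.measurable i
    have hmv : Measurable fun x => ∏ v : V, k (.inl (.inl v)) x :=
      Finset.measurable_prod _ fun i _ => hk.measurable _
    have hprod : ∀ x, ∏ i, k i x = (∏ v : V, k (.inl (.inl v)) x) * ∏ i ∈ S, k i x := by
      intro x
      rw [← Finset.prod_compl_mul_prod S]
      congr 1
      symm
      refine Finset.prod_nbij (fun v => .inl (.inl v)) ?_ ?_ ?_ fun _ _ => rfl
      · intro v _
        exact Finset.mem_compl.2 (hvS v)
      · intro a _ b _ hab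
        simpa using hab
      · intro i hi
        have hi : i ∉ S := Finset.mem_compl.1 (Finset.mem_coe.1 hi)
        rw [hS] at hi
        push Not at hi
        obtain ⟨v, rfl⟩ := hi
        exact ⟨v, by simp, rfl⟩
    have hF : Measurable fun x => f (res x) * ∏ v : V, k (.inl (.inl v)) x :=
      (hf.comp hres.measurable).mul hmv
    have hresZ : ∀ x u, res (Z x u) = res x := fun x u => funext fun v => hZv x u _ (hvS v)
    calc ∫⁻ x, f x ∂margDist (margDist ((Measure.pi ν).withDensity fun x => ∏ i, k i x))
        = ∫⁻ x, f (res x) ∂(Measure.pi ν).withDensity fun x => ∏ i, k i x := by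
          rw [margDist, lintegral_map hf (measurable_comp_inl _), margDist,
            lintegral_map (f := fun x : ∀ i, ExpandSpace X W i => f fun v => x (.inl v))
              (hf.comp (measurable_comp_inl _)) (measurable_comp_inl _)]
      _ = ∫⁻ x, (f (res x) * ∏ v : V, k (.inl (.inl v)) x) * ∏ i ∈ S, k i x ∂Measure.pi ν := by
          rw [lintegral_withDensity_eq_lintegral_mul _ hm (g := fun x => f (res x))
            (hf.comp hres.measurable)]
          refine lintegral_congr fun x => ?_
          rw [Pi.mul_apply, hprod, mul_comm, ← mul_assoc]
      _ = ∫⁻ x, (∫⁻ u, f (res (Z x u)) * ∏ v : V, k (.inl (.inl v)) (Z x u)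
            ∂Measure.pi fun _ => volume) ∂Measure.pi ν :=
          lintegral_mul_prod_eq_lintegral_lintegral ν hk.measurable hSP hF (hZi _ hF)
      _ = ∫⁻ x, (∫⁻ u, f (res (Z (ext (res x)) u)) * ∏ v : V, k (.inl (.inl v)) (Z (ext (res x)) u)
            ∂Measure.pi fun _ => volume) ∂Measure.pi ν := by
          refine lintegral_congr fun x => ?_
          rw [hZi _ hF, hZi _ hF]
          refine dependsOn_lmarginal ν S _ fun i hi => ?_
          have hi : i ∉ S := hi
          rw [hS] at hi
          push Not at hi
          obtain ⟨v, rfl⟩ := hi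
          rfl
      _ = ∫⁻ z, (∫⁻ u, f (res (Z (ext z) u)) * ∏ v : V, k (.inl (.inl v)) (Z (ext z) u)
            ∂Measure.pi fun _ => volume) ∂Measure.pi μ := by
          refine hres.lintegral_comp (f := fun z =>
            ∫⁻ u, f (res (Z (ext z) u)) * ∏ v : V, k (.inl (.inl v)) (Z (ext z) u)
              ∂Measure.pi fun _ => volume) ?_
          refine Measurable.lintegral_prod_right' (f := fun p : (∀ v, X v) × _ =>
            f (res (Z (ext p.1) p.2)) * ∏ v : V, k (.inl (.inl v)) (Z (ext p.1) p.2)) ?_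
          exact hF.comp (hZm.comp ((hext.comp measurable_fst).prodMk measurable_snd))
      _ = ∫⁻ z, (∫⁻ e, f z * ∏ v : V, k (.inl (.inl v)) (ψ z e)
            ∂Measure.pi fun _ => volume) ∂Measure.pi μ := by
          refine lintegral_congr fun z => ?_
          rw [← hgm.lintegral_comp (f := fun u => f (res (Z (ext z) u)) *
            ∏ v : V, k (.inl (.inl v)) (Z (ext z) u))
            (hF.comp (hZm.comp (measurable_const.prodMk measurable_id)))]
          refine lintegral_congr fun e => ?_
          rw [hresZ]
      _ = _ := by
          refine (lintegral_expand μ G.Clique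
            (f := fun z e => f z * ∏ v : V, k (.inl (.inl v)) (ψ z e)) ?_).symm
          exact (hf.comp measurable_fst).mul (hmv.comp hψ)

end MixedGraph

/-! ### Marginal graphs -/

namespace MixedGraph

theorem IsAcyclic.exists_rank {V : Type*} [Finite V] {G : MixedGraph V} (hG : G.IsAcyclic) :
    ∃ r : V → ℕ, ∀ i j, G.dir i j → r i < r j := by
  -- The rank of a vertex is the number of its proper ancestors.
  refine ⟨fun j => {i | Relation.TransGen G.dir i j}.ncard, fun i j hij => ?_⟩
  refine Set.ncard_lt_ncard ⟨fun a ha => Relation.TransGen.tail ha hij, fun h => ?_⟩ (Set.toFinite _)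
  exact hG i (h (Relation.TransGen.single hij))

theorem isAcyclic_of_rank {V : Type*} {G : MixedGraph V} {r : V → ℕ}
    (hr : ∀ i j, G.dir i j → r i < r j) : G.IsAcyclic := by
  have h : ∀ i j, Relation.TransGen G.dir i j → r i < r j := fun i j hij => by
    induction hij with
    | single h => exact hr _ _ h
    | tail _ h ih => exact ih.trans (hr _ _ h)
  exact fun j hj => (h j j hj).false

section Arcs

variable {V : Type*} {G : MixedGraph V} {L : Set V} {r : V → ℕ}

theorem IsWalk.cons {w : List (Step V)} {s : Step V} {k : V} (hs : s.IsEdgeOf G)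
    (h : G.IsWalk w s.tgt k) : G.IsWalk (s :: w) s.src k where
  isEdgeOf t ht := by
    rcases List.mem_cons.1 ht with rfl | ht
    · exact hs
    · exact h.isEdgeOf t ht
  connected := by
    obtain ⟨a, ha, hat⟩ := h.head
    refine List.isChain_cons.2 ⟨fun b hb => ?_, h.connected⟩
    obtain rfl : a = b := Option.mem_unique ha hb
    exact hat.symm
  head := ⟨s, by simp, rfl⟩
  last := by
    obtain ⟨l, hl, hlk⟩ := h.last
    refine ⟨l, ?_, hlk⟩
    cases w with
    | nil => simp at hl
    | cons a w => simpa using hl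

theorem IsWalk.ne_nil {w : List (Step V)} {j k : V} (h : G.IsWalk w j k) : w ≠ [] := by
  rintro rfl
  obtain ⟨s, hs, -⟩ := h.head
  simp at hs

theorem NoInner.cons {w : List (Step V)} {s : Step V} {J : Set V} (h : NoInner w J)
    (hs : s.tgt ∉ J) : NoInner (s :: w) J := by
  cases w with
  | nil => intro t ht; simp at ht
  | cons a w =>
    intro t ht
    rw [List.dropLast_cons_of_ne_nil (by simp)] at ht
    rcases List.mem_cons.1 ht with rfl | ht
    · exact hs
    · exact h t ht

/-- In an acyclic graph, a directed walk through latent vertices is a directed path. -/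
theorem DirReach.exists_isDirectedPath (hr : ∀ i j, G.dir i j → r i < r j) {a b : V}
    (h : G.DirReach L a b) :
    ∃ w, G.IsDirectedPath w a b ∧ NoInner w Lᶜ ∧ ∀ x ∈ a :: w.map Step.tgt, r a ≤ r x := by
  induction h with
  | @single a b h =>
    have hlt := hr a b h
    refine ⟨[⟨a, b, .right⟩], ⟨⟨⟨by simpa [Step.IsEdgeOf] using h, List.isChain_singleton _,
      ⟨_, rfl, rfl⟩, ⟨_, rfl, rfl⟩⟩, ?_⟩, by simp⟩, by simp [NoInner], by simp [hlt.le]⟩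
    simp only [List.map_cons, List.map_nil, List.nodup_cons, List.mem_singleton, List.not_mem_nil,
      not_false_eq_true, List.nodup_nil, and_self, and_true]
    rintro rfl
    exact hlt.false
  | @head a c b h hc _ ih =>
    obtain ⟨w, hw, hn, hx⟩ := ih
    have hlt := hr a c h
    have hx' : ∀ x ∈ c :: w.map Step.tgt, r a < r x := fun x hxw => hlt.trans_le (hx x hxw)
    refine ⟨⟨a, c, .right⟩ :: w, ⟨⟨IsWalk.cons (s := ⟨a, c, .right⟩) h hw.1.toIsWalk, ?_⟩, ?_⟩,
      hn.cons (by simpa using hc), ?_⟩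
    · exact List.nodup_cons.2 ⟨fun ha => (hx' a ha).false, hw.1.nodup⟩
    · intro s hs
      rcases List.mem_cons.1 hs with rfl | hs
      · rfl
      · exact hw.2 s hs
    · intro x hxw
      rcases List.mem_cons.1 hxw with rfl | hxw
      · exact le_rfl
      · exact (hx' x hxw).le

/-- `x` is the vertex `b`, or a latent vertex that reaches `b` through latent vertices. -/
def LatentAncestor (G : MixedGraph V) (L : Set V) (x b : V) : Prop :=
  x = b ∨ (x ∈ L ∧ G.DirReach L x b)

theorem IsConfoundingArc.mem_vertices_reverse {w : List (Step V)} {j k x : V}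
    (h : G.IsConfoundingArc w j k) (hx : x ∈ k :: ((w.map Step.rev).reverse).map Step.tgt) :
    x ∈ j :: w.map Step.tgt := by
  rw [h.toIsWalk.vertices]
  simpa [Step.rev, or_comm] using hx

/-- A confounding arc that starts at a latent vertex `c` is prolonged along a directed walk from
`c` to `j`. A new vertex does not repeat an earlier one: common ancestors of the two end points
`j` and `k` have lower rank. -/
theorem IsConfoundingArc.extend (hr : ∀ i j, G.dir i j → r i < r j) {j k c d : V}
    (hc : G.LatentAncestor L c j) {w : List (Step V)} (hw : G.IsConfoundingArc w c d)
    (hn : NoInner w Lᶜ)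
    (hcom : ∀ x, G.LatentAncestor L x j → G.LatentAncestor L x k → r x ≤ r c)
    (hv : ∀ x ∈ c :: w.map Step.tgt, r x ≤ r c ∨ G.LatentAncestor L x k) :
    ∃ w', G.IsConfoundingArc w' j d ∧ NoInner w' Lᶜ ∧
      ∀ x ∈ j :: w'.map Step.tgt, x ∈ c :: w.map Step.tgt ∨ G.LatentAncestor L x j := by
  have step : ∀ {c c'}, G.dir c c' → c ∈ L → G.LatentAncestor L c' j → ∀ {w},
      G.IsConfoundingArc w c d → NoInner w Lᶜ →
      (∀ x, G.LatentAncestor L x j → G.LatentAncestor L x k → r x ≤ r c) →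
      (∀ x ∈ c :: w.map Step.tgt, r x ≤ r c ∨ G.LatentAncestor L x k) →
      G.IsConfoundingArc (⟨c', c, .left⟩ :: w) c' d ∧ NoInner (⟨c', c, .left⟩ :: w) Lᶜ := by
    intro c c' hcc' hcL hc'j w hw hn hcom hv
    have hlt := hr _ _ hcc'
    refine ⟨⟨⟨IsWalk.cons (s := ⟨c', c, .left⟩) hcc' hw.toIsWalk, ?_⟩, ?_, ?_,
      ?_⟩, hn.cons (by simpa using hcL)⟩
    · refine List.nodup_cons.2 ⟨fun hmem => ?_, hw.nodup⟩
      rcases hv c' hmem with h | h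
      · exact hlt.not_ge h
      · exact hlt.not_ge (hcom c' hc'j h)
    · exact List.isChain_cons.2 ⟨fun _ _ h => by simp [Step.Collider, Step.HeadAtTgt] at h,
        hw.noCollider⟩
    · intro s hs
      obtain rfl : _ = s := by simpa using hs
      exact .inl rfl
    · intro s hs
      refine hw.headTgt s ?_
      cases w with
      | nil => exact (hw.toIsWalk.ne_nil rfl).elim
      | cons a w => simpa using hs
  rcases hc with rfl | ⟨hcL, hcj⟩
  · exact ⟨w, hw, hn, fun x hx => .inl hx⟩
  · induction hcj generalizing w with
    | single h =>
      obtain ⟨h1, h2⟩ := step h hcL (.inl rfl) hw hn hcom hv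
      refine ⟨_, h1, h2, fun x hx => ?_⟩
      rcases List.mem_cons.1 hx with rfl | hx
      · exact .inr (.inl rfl)
      · exact .inl hx
    | @head c c' j h hc'L hc'j ih =>
      obtain ⟨h1, h2⟩ := step h hcL (.inr ⟨hc'L, hc'j⟩) hw hn hcom hv
      have hle := (hr _ _ h).le
      obtain ⟨w', h3, h4, h5⟩ := ih h1 h2 (fun x hxj hxk => (hcom x hxj hxk).trans hle)
        (fun x hx => by
          rcases List.mem_cons.1 hx with rfl | hx
          · exact .inl le_rfl
          · exact (hv x hx).imp_left fun h => h.trans hle) step hc'L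
      refine ⟨w', h3, h4, fun x hx => ?_⟩
      rcases h5 x hx with h | h
      · rcases List.mem_cons.1 h with rfl | h
        · exact .inr (.inr ⟨hc'L, hc'j⟩)
        · exact .inl h
      · exact .inr h

/-- A confounding arc between latent ancestors of `j` and `k` is prolonged at both of its ends. -/
theorem IsConfoundingArc.extend_both (hr : ∀ i j, G.dir i j → r i < r j) {j k c d : V}
    (hc : G.LatentAncestor L c j) (hd : G.LatentAncestor L d k) {w : List (Step V)}
    (hw : G.IsConfoundingArc w c d) (hn : NoInner w Lᶜ)
    (hcom : ∀ x, G.LatentAncestor L x j → G.LatentAncestor L x k → r x ≤ r c ∧ r x ≤ r d)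
    (hv : ∀ x ∈ c :: w.map Step.tgt, (r x ≤ r c ∨ G.LatentAncestor L x k) ∧
      (r x ≤ r d ∨ G.LatentAncestor L x j)) :
    ∃ w', G.IsConfoundingArc w' j k ∧ NoInner w' Lᶜ := by
  obtain ⟨w₁, h1, h2, h3⟩ := hw.extend hr hc hn (fun x hj hk => (hcom x hj hk).1)
    fun x hx => (hv x hx).1
  obtain ⟨w₂, h4, h5, -⟩ := h1.reverse.extend (k := j) hr hd (h1.toIsWalk.noInner_reverse h2)
    (fun x hk hj => (hcom x hj hk).2) fun x hx =>
      (h3 x (h1.mem_vertices_reverse hx)).elim (fun h => (hv x h).2) .inr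
  exact ⟨_, h4.reverse, h4.toIsWalk.noInner_reverse h5⟩

/-- A latent common ancestor of two observed vertices yields a confounding arc. The arc leaves a
common ancestor of maximal rank in both directions. -/
theorem exists_isConfoundingArc_of_common [Finite V] (hr : ∀ i j, G.dir i j → r i < r j)
    {a j k : V} (hj : j ∉ L) (hk : k ∉ L) (hjk : j ≠ k) (ha : a ∈ L) (haj : G.DirReach L a j)
    (hak : G.DirReach L a k) : ∃ w, G.IsConfoundingArc w j k ∧ NoInner w Lᶜ := by
  obtain ⟨b, ⟨hbL, hbj, hbk⟩, hmax⟩ := Set.exists_max_image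
    {b | b ∈ L ∧ G.DirReach L b j ∧ G.DirReach L b k} r (Set.toFinite _) ⟨a, ha, haj, hak⟩
  have hcom : ∀ x, G.LatentAncestor L x j → G.LatentAncestor L x k → r x ≤ r b := by
    rintro x (rfl | ⟨hxL, hxj⟩) (rfl | ⟨hxL', hxk⟩)
    · exact (hjk rfl).elim
    · exact (hj hxL').elim
    · exact (hk hxL).elim
    · exact hmax x ⟨hxL, hxj, hxk⟩
  have hfirst : ∀ {t}, G.DirReach L b t → ∃ c, G.dir b c ∧ G.LatentAncestor L c t := by
    intro t h
    cases h with
    | single h => exact ⟨t, h, .inl rfl⟩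
    | head h hc h' => exact ⟨_, h, .inr ⟨hc, h'⟩⟩
  obtain ⟨c, hbc, hc⟩ := hfirst hbj
  obtain ⟨d, hbd, hd⟩ := hfirst hbk
  have hltc := hr _ _ hbc
  have hltd := hr _ _ hbd
  have hcd : c ≠ d := by
    rintro rfl
    exact hltc.not_ge (hcom c hc hd)
  refine IsConfoundingArc.extend_both hr hc hd (w := [⟨c, b, .left⟩, ⟨b, d, .right⟩])
    ⟨⟨⟨?_, ?_, ⟨_, rfl, rfl⟩, ⟨_, rfl, rfl⟩⟩, ?_⟩, ?_, ?_, ?_⟩ ?_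
    (fun x hxj hxk => ⟨(hcom x hxj hxk).trans hltc.le, (hcom x hxj hxk).trans hltd.le⟩) ?_
  · simpa [Step.IsEdgeOf] using ⟨hbc, hbd⟩
  · simp
  · have h1 : c ≠ b := fun h => (h ▸ hltc).false
    have h2 : b ≠ d := fun h => (h ▸ hltd).false
    simp [h1, h2, hcd]
  · simp [Step.Collider, Step.HeadAtTgt]
  · simp [Step.HeadAtSrc]
  · simp [Step.HeadAtTgt]
  · simpa [NoInner] using hbL
  · intro x hx
    simp only [List.map_cons, List.map_nil, List.mem_cons, List.not_mem_nil, or_false] at hx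
    rcases hx with rfl | rfl | rfl
    · exact ⟨.inl le_rfl, .inr hc⟩
    · exact ⟨.inl hltc.le, .inl hltd.le⟩
    · exact ⟨.inr hd, .inl le_rfl⟩

/-- Two observed vertices with latent ancestors that are joined by a bidirected edge are joined by
a confounding arc. -/
theorem exists_isConfoundingArc_of_bidir [Finite V] (hr : ∀ i j, G.dir i j → r i < r j)
    {c d j k : V} (hj : j ∉ L) (hk : k ∉ L) (hjk : j ≠ k) (hcd : G.bidir c d)
    (hc : G.LatentAncestor L c j) (hd : G.LatentAncestor L d k) :
    ∃ w, G.IsConfoundingArc w j k ∧ NoInner w Lᶜ := by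
  by_cases hcom : ∃ x, G.LatentAncestor L x j ∧ G.LatentAncestor L x k
  · obtain ⟨x, hxj, hxk⟩ := hcom
    rcases hxj with rfl | ⟨hxL, hxj⟩ <;> rcases hxk with rfl | ⟨hxL', hxk⟩
    · exact (hjk rfl).elim
    · exact (hj hxL').elim
    · exact (hk hxL).elim
    · exact exists_isConfoundingArc_of_common hr hj hk hjk hxL hxj hxk
  · push Not at hcom
    have hne : c ≠ d := by
      rintro rfl
      exact hcom c hc hd
    refine IsConfoundingArc.extend_both hr hc hd (w := [⟨c, d, .bi⟩])
      ⟨⟨⟨?_, ?_, ⟨_, rfl, rfl⟩, ⟨_, rfl, rfl⟩⟩, ?_⟩, ?_, ?_, ?_⟩ ?_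
      (fun x hxj hxk => (hcom x hxj hxk).elim) ?_
    · simpa [Step.IsEdgeOf] using hcd
    · simp
    · simp [hne]
    · simp
    · simp [Step.HeadAtSrc]
    · simp [Step.HeadAtTgt]
    · simp [NoInner]
    · intro x hx
      simp only [List.map_cons, List.map_nil, List.mem_cons, List.not_mem_nil, or_false] at hx
      rcases hx with rfl | rfl
      · exact ⟨.inl le_rfl, .inr hc⟩
      · exact ⟨.inr hd, .inl le_rfl⟩

end Arcs

section Expansion

variable {V : Type u} {G : MixedGraph V}

theorem cliqueExpansion_mem_classDAG [Finite V] (hG : G ∈ classADMG V) :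
    G.cliqueExpansion ∈ classDAG (V ⊕ G.Clique) := by
  obtain ⟨r, hr⟩ := hG.2.exists_rank
  obtain ⟨r', hr'⟩ := exists_rank_cliqueExpansion hr
  exact ⟨⟨fun _ => rfl, isAcyclic_of_rank hr'⟩, cliqueExpansion_isDirected⟩

theorem classDAG_subset_classUA : classDAG V ⊆ classUA V :=
  fun _ h => ⟨h.1, fun j k hjk hb => (hjk (h.2 j k hb)).elim⟩

theorem not_mem_range_inl {A B : Type*} {x : A ⊕ B}
    (hx : x ∉ Set.range (Function.Embedding.inl : A ↪ A ⊕ B)) : ∃ b, x = .inr b := by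
  rcases x with a | b
  · exact (hx ⟨a, rfl⟩).elim
  · exact ⟨b, rfl⟩

/-- The latent vertices of the clique expansion have no parents, so no directed path runs through
them, and the confounding arcs are those of the form `j ← C → k`. -/
theorem marg_cliqueExpansion (hG : G ∈ classADMG V) :
    G.cliqueExpansion.marg Function.Embedding.inl = G := by
  classical
  ext j k
  · refine ⟨?_, fun h => ⟨?_, ?_⟩⟩
    · rintro ⟨-, w, ⟨hw, hright⟩, hn⟩
      match w, hw, hright, hn with
      | [], hw, _, _ => exact (hw.toIsWalk.ne_nil rfl).elim
      | [s], hw, hright, _ =>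
        obtain ⟨a, ha, haj⟩ := hw.head
        obtain ⟨b, hb, hbk⟩ := hw.last
        obtain rfl : s = a := by simpa using ha
        obtain rfl : s = b := by simpa using hb
        have he := hw.isEdgeOf s (by simp)
        have ht := hright s (by simp)
        obtain ⟨x, y, t⟩ := s
        subst haj hbk ht
        exact he
      | s :: t :: w, hw, hright, hn =>
        have he := hw.isEdgeOf s (by simp)
        have ht := hright s (by simp)
        obtain ⟨C, hC⟩ := not_mem_range_inl (hn s (by simp))
        obtain ⟨x, y, t⟩ := s
        subst hC ht
        rcases x with x | x <;> exact he.elim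
    · rintro rfl
      exact hG.2 j (.single h)
    · refine ⟨[⟨.inl j, .inl k, .right⟩], ⟨⟨⟨fun s hs => by
          obtain rfl := List.mem_singleton.1 hs
          exact h, by simp,
        ⟨_, rfl, rfl⟩, ⟨_, rfl, rfl⟩⟩, ?_⟩, by simp⟩, by simp [NoInner]⟩
      have : j ≠ k := by
        rintro rfl
        exact hG.2 j (.single h)
      simpa using this
  · refine ⟨?_, fun h => ?_⟩
    · rintro (rfl | ⟨w, hw, hn⟩)
      · exact hG.1 j
      · match w, hw, hn with
        | [], hw, _ => exact (hw.toIsWalk.ne_nil rfl).elim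
        | [s], hw, _ =>
          have h1 := hw.headSrc s (by simp)
          have h2 := hw.headTgt s (by simp)
          have he := hw.isEdgeOf s (by simp)
          obtain ⟨a, ha, haj⟩ := hw.head
          obtain rfl : s = a := by simpa using ha
          have hnd := hw.nodup
          obtain ⟨x, y, t⟩ := s
          subst haj
          cases t
          · simp [Step.HeadAtSrc] at h1
          · simp [Step.HeadAtTgt] at h2
          · obtain rfl : Sum.inl j = y := he
            simp at hnd
        | s :: t :: w, hw, hn =>
          have h1 := hw.headSrc s (by simp)
          have he := hw.isEdgeOf s (by simp)
          have het := hw.isEdgeOf t (by simp)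
          obtain ⟨a, ha, haj⟩ := hw.head
          obtain rfl : s = a := by simpa using ha
          have hnd := hw.nodup
          have hst := (List.isChain_cons_cons.1 hw.connected).1
          obtain ⟨C, hC⟩ := not_mem_range_inl (hn s (by simp))
          have hlast := hw.last
          obtain ⟨x, y, e⟩ := s
          obtain ⟨x', y', e'⟩ := t
          subst haj hst hC
          have hjC : j ∈ C.1 := by
            cases e
            · simp [Step.HeadAtSrc] at h1
            · exact he
            · cases he
          have hy' : ∃ i, y' = .inl i ∧ i ∈ C.1 := by
            cases e'
            · rcases y' with i | C'
              · exact ⟨i, rfl, het⟩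
              · exact het.elim
            · rcases y' with i | C' <;> exact het.elim
            · obtain rfl : Sum.inr C = y' := het
              simp at hnd
          obtain ⟨i, rfl, hi⟩ := hy'
          cases w with
          | nil =>
            obtain ⟨b, hb, hbk⟩ := hlast
            simp only [List.getLast?_cons_cons, List.getLast?_singleton, Option.mem_def,
              Option.some.injEq] at hb
            subst hb
            obtain rfl : i = k := Sum.inl_injective hbk
            exact C.2 _ hjC _ hi
          | cons b w => exact (hn ⟨.inr C, .inl i, e'⟩ (by simp) ⟨i, rfl⟩).elim
    · by_cases hjk : j = k
      · exact .inl hjk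
      · let C : G.Clique := ⟨{j, k}, by
          have := G.bidir_symm j k h
          simp [hG.1 j, hG.1 k, h, this]⟩
        have hjC : j ∈ C.1 := by simp [C]
        have hkC : k ∈ C.1 := by simp [C]
        refine .inr ⟨[⟨.inl j, .inr C, .left⟩, ⟨.inr C, .inl k, .right⟩],
          ⟨⟨⟨?_, by simp, ⟨_, rfl, rfl⟩, ⟨_, rfl, rfl⟩⟩, ?_⟩, ?_, ?_, ?_⟩, ?_⟩
        · intro s hs
          simp only [List.mem_cons, List.not_mem_nil, or_false] at hs
          rcases hs with rfl | rfl
          · exact hjC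
          · exact hkC
        · simp [hjk]
        · simp [Step.Collider, Step.HeadAtTgt]
        · simp [Step.HeadAtSrc]
        · simp [Step.HeadAtTgt]
        · simp [NoInner]

end Expansion

end MixedGraph

/-! ### Comparison of the models -/

namespace MixedGraph

section Latent

variable {V W : Type*} {G' : MixedGraph (V ⊕ W)}

/-- Directed walks in a clique expansion whose inner vertices are not observed: a walk that starts
at the latent parent of a clique enters the graph at a vertex of this clique. -/
theorem DirReach.of_cliqueExpansion {a : (V ⊕ W) ⊕ G'.Clique} {y : V ⊕ W}
    (h : G'.cliqueExpansion.DirReach {i | ∀ v, i ≠ .inl (.inl v)} a (.inl y)) :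
    (∀ x, a = .inl x → G'.DirReach (Set.range (Sum.inl : V → V ⊕ W))ᶜ x y) ∧
      ∀ C, a = .inr C → ∃ c ∈ C.1, G'.LatentAncestor (Set.range (Sum.inl : V → V ⊕ W))ᶜ c y := by
  generalize hb : (Sum.inl y : (V ⊕ W) ⊕ G'.Clique) = b at h
  induction h with
  | single h =>
    subst hb
    refine ⟨?_, ?_⟩
    · rintro x rfl
      exact .single h
    · rintro C rfl
      exact ⟨y, h, .inl rfl⟩
  | @head a c b h hc _ ih =>
    obtain ⟨ih, -⟩ := ih hb
    rcases c with z | C'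
    · have hz : z ∈ (Set.range (Sum.inl : V → V ⊕ W))ᶜ := by
        rintro ⟨v, rfl⟩
        exact hc v rfl
      refine ⟨?_, ?_⟩
      · rintro x rfl
        exact .head h hz (ih z rfl)
      · rintro C rfl
        exact ⟨z, h, .inr ⟨hz, ih z rfl⟩⟩
    · rcases a with x | C <;> exact h.elim

/-- The observed vertices that are influenced by the same latent vertex of the clique expansion,
directly or through other latent vertices, form a bidirected clique of the marginal graph. -/
theorem marg_bidir_of_common [Finite V] [Finite W] {r : V ⊕ W → ℕ}
    (hr : ∀ i j, G'.dir i j → r i < r j) {a : (V ⊕ W) ⊕ G'.Clique} (ha : ∀ v, a ≠ .inl (.inl v))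
    {j k : V} (hj : G'.cliqueExpansion.DirReach {i | ∀ v, i ≠ .inl (.inl v)} a (.inl (.inl j)))
    (hk : G'.cliqueExpansion.DirReach {i | ∀ v, i ≠ .inl (.inl v)} a (.inl (.inl k))) :
    (G'.marg Function.Embedding.inl).bidir j k := by
  by_cases hjk : j = k
  · exact .inl hjk
  have hobs : ∀ v : V, (.inl v : V ⊕ W) ∉ (Set.range (Sum.inl : V → V ⊕ W))ᶜ := fun v h =>
    h ⟨v, rfl⟩
  have hne : (.inl j : V ⊕ W) ≠ .inl k := fun h => hjk (Sum.inl_injective h)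
  suffices ∃ w, G'.IsConfoundingArc w (.inl j) (.inl k) ∧
      NoInner w (Set.range (Sum.inl : V → V ⊕ W))ᶜᶜ by
    obtain ⟨w, hw, hn⟩ := this
    rw [compl_compl] at hn
    exact .inr ⟨w, hw, hn⟩
  rcases a with x | C
  · have hx : x ∈ (Set.range (Sum.inl : V → V ⊕ W))ᶜ := by
      rintro ⟨v, rfl⟩
      exact ha v rfl
    exact exists_isConfoundingArc_of_common hr (hobs j) (hobs k) hne hx
      (hj.of_cliqueExpansion.1 x rfl) (hk.of_cliqueExpansion.1 x rfl)
  · obtain ⟨c, hc, hcj⟩ := hj.of_cliqueExpansion.2 C rfl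
    obtain ⟨d, hd, hdk⟩ := hk.of_cliqueExpansion.2 C rfl
    exact exists_isConfoundingArc_of_bidir hr (hobs j) (hobs k) hne (C.2 c hc d hd) hcj hdk

theorem marg_dir_of_dirReach {r : V ⊕ W → ℕ} (hr : ∀ i j, G'.dir i j → r i < r j) {j k : V}
    (h : G'.cliqueExpansion.DirReach {i | ∀ v, i ≠ .inl (.inl v)} (.inl (.inl j))
      (.inl (.inl k))) : (G'.marg Function.Embedding.inl).dir j k := by
  have h := h.of_cliqueExpansion.1 _ rfl
  refine ⟨?_, ?_⟩
  · rintro rfl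
    exact (h.rank_lt hr).false
  · obtain ⟨w, hw, hn, -⟩ := h.exists_isDirectedPath hr
    rw [compl_compl] at hn
    exact ⟨w, hw, hn⟩

end Latent

section Models

variable {V : Type*} [Fintype V] {X : V → Type} [∀ v, MeasurableSpace (X v)]
  (μ : ∀ v, Measure (X v)) [∀ v, SigmaFinite (μ v)]

/-- Marginalization maps the clique expansion model of an acyclic graph into the clique expansion
model of the marginal graph. -/
theorem margDist_image_CEModel_subset {W : Type*} [Fintype W] {G' : MixedGraph (V ⊕ W)}
    (hG' : G'.IsAcyclic) (hG : (G'.marg (Function.Embedding.inl : V ↪ V ⊕ W)).IsAcyclic) :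
    margDist '' G'.CEModel (expandMeasure μ W) ⊆ (G'.marg Function.Embedding.inl).CEModel μ := by
  classical
  rintro _ ⟨_, ⟨Q, hQ, rfl⟩, rfl⟩
  obtain ⟨r, hr⟩ := hG.exists_rank
  obtain ⟨r', hr'⟩ := hG'.exists_rank
  obtain ⟨rD, hrD⟩ := exists_rank_cliqueExpansion hr'
  let S : Finset ((V ⊕ W) ⊕ G'.Clique) := Finset.univ.filter fun i => ∀ v, i ≠ .inl (.inl v)
  have hS : ∀ i, i ∈ S ↔ ∀ v, i ≠ .inl (.inl v) := fun i => by simp [S]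
  have hS' : (S : Set ((V ⊕ W) ⊕ G'.Clique)) = {i | ∀ v, i ≠ .inl (.inl v)} := Set.ext hS
  -- Observed vertices carry no noise in the construction and are sent to the empty clique.
  let c : (V ⊕ W) ⊕ G'.Clique → (G'.marg (Function.Embedding.inl : V ↪ V ⊕ W)).Clique := fun a =>
    ⟨Finset.univ.filter fun v => a ∈ S ∧ G'.cliqueExpansion.DirReach S a (.inl (.inl v)), by
      intro j hj k hk
      obtain ⟨-, ha, hj⟩ := Finset.mem_filter.1 hj
      obtain ⟨-, -, hk⟩ := Finset.mem_filter.1 hk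
      rw [hS'] at hj hk
      exact marg_bidir_of_common hr' ((hS a).1 ha) hj hk⟩
  refine margDist_margDist_mem_CEModel μ hr hrD cliqueExpansion_isDirected hS (fun j v h => ?_) c
    (fun a ha v h => Finset.mem_filter.2 ⟨Finset.mem_univ _, ha, h⟩) hQ
  rw [hS'] at h
  exact marg_dir_of_dirReach hr' h

end Models

theorem unionOfExpandedCEModels_mono {V : Type u} [Fintype V] {X : V → Type}
    [∀ v, MeasurableSpace (X v)] {𝒢 𝒢' : ∀ V' : Type u, Set (MixedGraph V')}
    (h : ∀ V', 𝒢 V' ⊆ 𝒢' V') (G : MixedGraph V) (μ : ∀ v, Measure (X v)) :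
    G.unionOfExpandedCEModels 𝒢 μ ⊆ G.unionOfExpandedCEModels 𝒢' μ :=
  Set.iUnion_mono fun _ => Set.iUnion_mono fun _ =>
    Set.biUnion_subset_biUnion_left fun _ hG' => ⟨h _ hG'.1, hG'.2⟩

end MixedGraph

theorem mainTheorem5 {V : Type u} [Fintype V] (X : V → Type) [∀ v, MeasurableSpace (X v)]
    (μ : ∀ v, Measure (X v)) [∀ v, SigmaFinite (μ v)]
    (G : MixedGraph V) (hG : G ∈ MixedGraph.classADMG V) :
    G.CEModel μ = margDist '' G.cliqueExpansion.CEModel (expandMeasure μ G.Clique) ∧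
    G.CEModel μ = G.unionOfExpandedCEModels MixedGraph.classDAG μ ∧
    G.CEModel μ = G.unionOfExpandedCEModels MixedGraph.classUA μ ∧
    G.CEModel μ = G.unionOfExpandedCEModels MixedGraph.classADMG μ := by
  have hD := MixedGraph.cliqueExpansion_mem_classDAG hG
  have hmarg := MixedGraph.marg_cliqueExpansion hG
  have h1 : G.CEModel μ ⊆ margDist '' G.cliqueExpansion.CEModel (expandMeasure μ G.Clique) := by
    obtain ⟨r, hr⟩ := hD.1.2.exists_rank
    exact Set.image_mono (MixedGraph.globalMarkovModel_subset_CEModel _ hr hD.2)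
  have h2 : margDist '' G.cliqueExpansion.CEModel (expandMeasure μ G.Clique) ⊆
      G.unionOfExpandedCEModels MixedGraph.classDAG μ := fun P hP =>
    Set.mem_iUnion.2 ⟨G.Clique, Set.mem_iUnion.2 ⟨inferInstance,
      Set.mem_biUnion (x := G.cliqueExpansion) ⟨hD, hmarg⟩ hP⟩⟩
  have h3 : G.unionOfExpandedCEModels MixedGraph.classDAG μ ⊆
      G.unionOfExpandedCEModels MixedGraph.classUA μ :=
    MixedGraph.unionOfExpandedCEModels_mono (fun _ => MixedGraph.classDAG_subset_classUA) G μ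
  have h4 : G.unionOfExpandedCEModels MixedGraph.classUA μ ⊆
      G.unionOfExpandedCEModels MixedGraph.classADMG μ :=
    MixedGraph.unionOfExpandedCEModels_mono (fun _ _ h => h.1) G μ
  have h5 : G.unionOfExpandedCEModels MixedGraph.classADMG μ ⊆ G.CEModel μ := by
    refine Set.iUnion_subset fun W => Set.iUnion_subset fun _ => Set.iUnion₂_subset ?_
    rintro G' ⟨hG', rfl⟩
    exact MixedGraph.margDist_image_CEModel_subset μ hG'.2 hG.2
  exact ⟨h1.antisymm (h2.trans (h3.trans (h4.trans h5))),
    (h1.trans h2).antisymm (h3.trans (h4.trans h5)),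
    (h1.trans (h2.trans h3)).antisymm (h4.trans h5),
    (h1.trans (h2.trans (h3.trans h4))).antisymm h5⟩
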